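/- **Stateless programs.** Actor classes, method names and variables range over disjoint infinite sets; actor names are partitioned by the classes, each class having infinitely many names ($A\in C$). Values are variables or actor names. Expressions and processes are $$E ::= x \mid \mathtt{new}\;C,\qquad P ::= 0 \mid \mathtt{let}\;x=E\;\mathtt{in}\;P \mid x!m(\tilde E).P \mid [E=E']P;P \mid P+P,$$ up to renaming of bound variables. A stateless program consists of a main process and finitely many definitions $C.m(\tilde x)=P$ with distinct parameters, at most one for each pair $(C,m)$, where $P$ may use the implicit parameter $\mathit{this}$. At run time values may replace free variables. **Abstract transition system.** A configuration is a finite set of terms $A\triangleright(\sigma:P,q)$, at most one for each actor name $A$, where the decoration $\sigma$ is a sequence of naturals and $q$ is a queue of messages $m(\tilde U,\sigma,A')$ with $A'$ the addressee. Expressions are evaluated from left to right: values evaluate to themselves, and $\mathtt{new}\;C$ evaluates to the first actor name $A$ of $C$ unused in the configuration and adds $A\triangleright(\varepsilon:0,\varepsilon)$. The unlabelled transitions $\to_{\mathsf a}$ are (in any context): - *let*: $A\triangleright(\sigma\cdot n:\mathtt{let}\,x=E\,\mathtt{in}\,P,\,q)\to_{\mathsf a} A\triangleright(\sigma\cdot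 (n{+}1):P\{U/x\},\,q)$, where $E$ evaluates to $U$; - *invocation*: if $A$ runs $\sigma\cdot n:A'!m(\tilde E).P$ and $\tilde E$ evaluates to $\tilde U$, then $A$ continues with $\sigma\cdot (n{+}1):P$, and $m(\tilde U,\sigma\cdot (n{+}1),A')$ is appended to the queue of an arbitrary actor of the configuration (possibly $A$) of the same class as $A'$; - *instantiation*: if $A\in C$, $C.m(\tilde x)=P$ and $|\tilde U|=|\tilde x|$, then $A\triangleright(\sigma':0,\,m(\tilde U,\sigma,A')\cdot q)\to_{\mathsf a}A\triangleright(\sigma\cdot 0:P',\,q)$, where $P'$ is $P$ with $\mathit{this}$ replaced by $A'$, $\tilde x$ by $\tilde U$, and the other free variables by the least distinct variables that do not occur in the configuration and are not free in the main process; - *match*: $[E=E']P;Q$ continues as $P$ if $E,E'$ evaluate to the same value, and as $Q$ otherwise; *choice*: $P+Q$ continues as $P$ or as $Q$; in both cases the decoration $\sigma\cdot n$ becomes $\sigma\cdot(n{+}1)$. New actors created by an evaluation are added to the resulting configuration. The initial configuration is $\aleph\triangleright(0:P_{\rm main},\varepsilon)$, where the class of the root $\aleph$ has no methods and does not occur in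 the program. Let $\mathcal S$ be the set of configurations reachable from it by $\to_{\mathsf a}$. The program is *non-blocking* if in every configuration of $\mathcal S$ each actor whose process is not $0$ or whose queue is not empty can perform a transition (that is, actors never invoke a variable, and never receive a message that their class does not define with that number of arguments). **Ordering.** A renaming $\rho$ maps the variables that are not free in the main process to values, and fixes those that are. Write $\rho\doteq_{\mathsf a}\rho'$ if for all variables $x,y$ not free in the main process: $\rho(x)=\rho(y)$ iff $\rho'(x)=\rho'(y)$; for every class $C$, $\rho(x)\in C$ iff $\rho'(x)\in C$; and $\rho(x)=\rho'(x)$ whenever $\rho(x)$ or $\rho'(x)$ is a free variable of the main process. Put $P\rho\simeq_{\mathsf a}P\rho'$ for every process $P$ without actor names and all $\rho\doteq_{\mathsf a}\rho'$; and $m(\tilde U,\sigma,A)\simeq_{\mathsf a}m(\tilde U',\sigma',A')$ if there are variables $\tilde x,z$ and $\rho\doteq_{\mathsf a}\rho'$ with $(\tilde U,A)=(\rho(\tilde x),\rho(z))$ and $(\tilde U',A')=(\rho'(\tilde x),\rho'(z))$. For queues, $q\le_{\mathsf a}q'$ if $q$ is related by $\simeq_{\mathsf a}$, message by message, to a subsequence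 of $q'$. Finally $S\preceq_{\mathsf a}S'$ if there is an injection from the actors of $S$ to those of $S'$ such that, whenever $A\triangleright(\sigma:P,q)$ in $S$ is sent to $A'\triangleright(\sigma':P',q')$ in $S'$, $A$ and $A'$ have the same class, $P\simeq_{\mathsf a}P'$ and $q\le_{\mathsf a}q'$. **Theorem.** For every non-blocking stateless program, $(\mathcal S,\to_{\mathsf a},\preceq_{\mathsf a})$ is a well-structured transition system: $\to_{\mathsf a}$ is finitely branching, $\preceq_{\mathsf a}$ is a quasi-ordering and a well-quasi-ordering (every infinite sequence $S_1,S_2,\dots$ has $i<j$ with $S_i\preceq_{\mathsf a}S_j$), and $\preceq_{\mathsf a}$ is upward compatible: if $S_1\preceq_{\mathsf a}S_1'$ and $S_1\to_{\mathsf a}S_2$, then there is $S_2'$ with $S_1'\to_{\mathsf a}^*S_2'$ and $S_2\preceq_{\mathsf a}S_2'$. -/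

import Mathlib

/-! Stateless actor programs, their abstract (inexact delivery) operational semantics,
the ordering on configurations, and well-structured transition systems. -/

noncomputable section

namespace StatelessActor

/-! ### Names -/

abbrev ClassName := ℕ
abbrev MethName := ℕ
abbrev Var := ℕ

/-- The special variable `this`, an implicit formal parameter of every method. -/
def this : Var := 0

/-- Actor names, partitioned into infinitely many names for each class. The class `none` is the
class of the root actor: it has no methods and no program can create an actor of this class. -/
structure ActorName where
  cls : Option ClassName
  idx : ℕ
deriving DecidableEq

/-- The root actor, which executes the main process. -/
def root : ActorName := ⟨none, 0⟩

/-- Run-time values: variables and actor names. -/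
inductive Value where
  | var (x : Var)
  | actor (A : ActorName)
deriving DecidableEq

/-- The class of an actor name; `none` for a variable. Hence `u.cls = v.cls` says that,
for every class `C`, `u` is an actor name of `C` iff `v` is. -/
def Value.cls : Value → Option (Option ClassName)
  | .var _ => none
  | .actor A => some A.cls

/-! ### Syntax

Processes are taken up to alpha-conversion: the variables bound by `let` are represented by
de Bruijn levels (`bound 0` is the outermost one, the binder at depth `n` binds `Fin.last n`),
while free names are elements of `N`. Source processes have `N = Var`, run-time processes have
`N = Value`. As classes have no fields, `new` has no arguments, and there are neither field
expressions nor field updates. -/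

/-- An occurrence of a name below `n` binders. -/
inductive Name (N : Type) (n : ℕ) where
  | free (u : N)
  | bound (i : Fin n)

/-- `E ::= x | new C`. -/
inductive Expr (N : Type) (n : ℕ) where
  | name (a : Name N n)
  | new (C : ClassName)

/-- `P ::= 0 | let x = E in P | x ! m(E₁, …, Eₖ) . P | [E = E'] P ; Q | P + Q`. -/
inductive Proc (N : Type) : ℕ → Type where
  | nil {n : ℕ} : Proc N n
  | letin {n : ℕ} (E : Expr N n) (P : Proc N (n + 1)) : Proc N n
  | send {n : ℕ} (x : Name N n) (m : MethName) (Es : List (Expr N n)) (P : Proc N n) : Proc N n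
  | cond {n : ℕ} (E E' : Expr N n) (P Q : Proc N n) : Proc N n
  | plus {n : ℕ} (P Q : Proc N n) : Proc N n

/-! Simultaneous (capture-avoiding) replacement of the free names. -/

def Name.map {N N' : Type} {n : ℕ} (ρ : N → N') : Name N n → Name N' n
  | .free u => .free (ρ u)
  | .bound i => .bound i

def Expr.map {N N' : Type} {n : ℕ} (ρ : N → N') : Expr N n → Expr N' n
  | .name a => .name (a.map ρ)
  | .new C => .new C

def Proc.map {N N' : Type} (ρ : N → N') : {n : ℕ} → Proc N n → Proc N' n
  | _, .nil => .nil
  | _, .letin E P => .letin (E.map ρ) (P.map ρ)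
  | _, .send x m Es P => .send (x.map ρ) m (Es.map (Expr.map ρ)) (P.map ρ)
  | _, .cond E E' P Q => .cond (E.map ρ) (E'.map ρ) (P.map ρ) (Q.map ρ)
  | _, .plus P Q => .plus (P.map ρ) (Q.map ρ)

/-! Replacement of the outermost bound variable by the free name `u`. -/

def Name.inst {N : Type} {n : ℕ} (u : N) : Name N (n + 1) → Name N n
  | .free v => .free v
  | .bound i => Fin.cases (.free u) .bound i

def Expr.inst {N : Type} {n : ℕ} (u : N) : Expr N (n + 1) → Expr N n
  | .name a => .name (a.inst u)
  | .new C => .new C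

def Proc.inst {N : Type} (u : N) : {n : ℕ} → Proc N (n + 1) → Proc N n
  | _, .nil => .nil
  | _, .letin E P => .letin (E.inst u) (P.inst u)
  | _, .send x m Es P => .send (x.inst u) m (Es.map (Expr.inst u)) (P.inst u)
  | _, .cond E E' P Q => .cond (E.inst u) (E'.inst u) (P.inst u) (Q.inst u)
  | _, .plus P Q => .plus (P.inst u) (Q.inst u)

/-! The list of the free names, with repetitions. -/

def Name.names {N : Type} {n : ℕ} : Name N n → List N
  | .free u => [u]
  | .bound _ => []

def Expr.names {N : Type} {n : ℕ} : Expr N n → List N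
  | .name a => a.names
  | .new _ => []

def Proc.names {N : Type} : {n : ℕ} → Proc N n → List N
  | _, .nil => []
  | _, .letin E P => E.names ++ P.names
  | _, .send x _ Es P => x.names ++ Es.flatMap Expr.names ++ P.names
  | _, .cond E E' P Q => E.names ++ E'.names ++ P.names ++ Q.names
  | _, .plus P Q => P.names ++ Q.names

/-- A method definition `m(x₁, …, xₖ) = P`; the body may contain `this` and further
free variables, which stand for fresh variables at each instantiation. -/
structure MethodDef where
  params : List Var
  nodup : params.Nodup
  this_notMem : this ∉ params
  body : Proc Var 0

/-- A stateless program: a main process and finitely many method definitions, at most one for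
each class and method name. -/
structure Program where
  main : Proc Var 0
  defs : ClassName → MethName → Option MethodDef
  finite_defs : {p : ClassName × MethName | (defs p.1 p.2).isSome}.Finite

/-! ### Configurations -/

/-- Decorations: `σ ++ [n]` says that the process has made `n` steps since it was instantiated
by the message sent at `σ`. -/
abbrev Deco := List ℕ

/-- A message `m(U₁, …, Uₖ, σ, A)`, where `A` is the actor to which it was addressed. -/
structure Msg where
  meth : MethName
  args : List Value
  deco : Deco
  target : ActorName

/-- The term `(σ : P, ∅, q)` associated with an actor name. -/
structure ActorState where
  deco : Deco
  proc : Proc Value 0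
  queue : List Msg

/-- Configurations: finite sets of terms `A ▷ (σ : P, ∅, q)`, at most one for each `A`. -/
abbrev Config := Finmap (fun _ : ActorName => ActorState)

/-- The value `u` occurs in the configuration `S`. -/
def Occurs (u : Value) (S : Config) : Prop :=
  ∃ A a, S.lookup A = some a ∧
    (u = .actor A ∨ u ∈ a.proc.names ∨ ∃ μ ∈ a.queue, u ∈ μ.args ∨ u = .actor μ.target)

/-- The first unused actor name of the class `C`. -/
def freshActor (S : Config) (C : ClassName) : ActorName :=
  ⟨some C, sInf {i | ¬ Occurs (.actor ⟨some C, i⟩) S}⟩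

/-- The `i`-th unused variable (starting from `0`). The free variables of the main process are
never reused, even when they do not occur any more in the configuration. -/
def freshVar (prog : Program) (S : Config) (i : ℕ) : Var :=
  Nat.nth (fun x => x ∉ prog.main.names ∧ ¬ Occurs (.var x) S) i

/-- Evaluation of an expression without bound variables: the value, and the configuration
extended with the actor possibly created. -/
def evalOne (S : Config) : Expr Value 0 → Value × Config
  | .name (.free u) => (u, S)
  | .name (.bound i) => i.elim0
  | .new C => (.actor (freshActor S C), S.insert (freshActor S C) ⟨[], .nil, []⟩)

/-- Evaluation of a tuple of expressions, from left to right. -/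
def evalList (S : Config) : List (Expr Value 0) → List Value × Config
  | [] => ([], S)
  | E :: Es =>
    let r := evalOne S E
    let rs := evalList r.2 Es
    (r.1 :: rs.1, rs.2)

/-- The free variables of a method body that are not formal parameters. -/
def MethodDef.newVars (d : MethodDef) : List Var :=
  d.body.names.dedup.filter (fun x => x ≠ this ∧ x ∉ d.params)

/-- The instance of the body of `d` with `this` replaced by `A`, the formal parameters replaced
by `U`, and the other free variables replaced by the least unused variables. -/
def MethodDef.instantiate (prog : Program) (S : Config) (d : MethodDef) (A : ActorName)
    (U : List Value) : Proc Value 0 :=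
  d.body.map fun x =>
    if x = this then .actor A
    else match (d.params.zip U).lookup x with
      | some u => u
      | none => .var (freshVar prog S (d.newVars.idxOf x))

/-! ### The abstract transition relation -/

/-- Labels `σ` and `σ | m(U₁, …, Uₖ, A)`. -/
inductive Label where
  | step (σ : Deco)
  | call (σ : Deco) (m : MethName) (U : List Value) (A : ActorName)

/-- `LStep prog A S α S'`: the actor `A` of the configuration `S` performs an abstract transition
with label `α` to `S'`. The closure under contexts is built in: `S` is the whole configuration,
and freshness refers to it. -/
inductive LStep (prog : Program) (A : ActorName) (S : Config) : Label → Config → Prop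
  | letin {σ : Deco} {n : ℕ} {E : Expr Value 0} {P : Proc Value 1} {q : List Msg}
      {U : Value} {T : Config}
      (hA : S.lookup A = some ⟨σ ++ [n], .letin E P, q⟩)
      (hE : evalOne S E = (U, T)) :
      LStep prog A S (.step (σ ++ [n + 1]))
        (T.insert A ⟨σ ++ [n + 1], P.inst U, q⟩)
  | invkSelf {σ : Deco} {n : ℕ} {A' : ActorName} {m : MethName} {Es : List (Expr Value 0)}
      {P : Proc Value 0} {q : List Msg} {U : List Value} {T : Config}
      (hA : S.lookup A = some ⟨σ ++ [n], .send (.free (.actor A')) m Es P, q⟩)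
      (hcls : A.cls = A'.cls)
      (hE : evalList S Es = (U, T)) :
      LStep prog A S (.call (σ ++ [n + 1]) m U A')
        (T.insert A ⟨σ ++ [n + 1], P, q ++ [⟨m, U, σ ++ [n + 1], A'⟩]⟩)
  | invk {σ σ' : Deco} {n : ℕ} {A' A'' : ActorName} {m : MethName} {Es : List (Expr Value 0)}
      {P P' : Proc Value 0} {q q' : List Msg} {U : List Value} {T : Config}
      (hA : S.lookup A = some ⟨σ ++ [n], .send (.free (.actor A')) m Es P, q⟩)
      (hne : A'' ≠ A)
      (hA'' : S.lookup A'' = some ⟨σ', P', q'⟩)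
      (hcls : A''.cls = A'.cls)
      (hE : evalList S Es = (U, T)) :
      LStep prog A S (.call (σ ++ [n + 1]) m U A')
        ((T.insert A ⟨σ ++ [n + 1], P, q⟩).insert A''
          ⟨σ', P', q' ++ [⟨m, U, σ ++ [n + 1], A'⟩]⟩)
  | inst {σ σ' : Deco} {C : ClassName} {m : MethName} {d : MethodDef} {U : List Value}
      {A' : ActorName} {q : List Msg}
      (hA : S.lookup A = some ⟨σ', .nil, ⟨m, U, σ, A'⟩ :: q⟩)
      (hcls : A.cls = some C)
      (hd : prog.defs C m = some d)
      (hU : U.length = d.params.length) :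
      LStep prog A S (.step (σ ++ [0]))
        (S.insert A ⟨σ ++ [0], d.instantiate prog S A' U, q⟩)
  | condEq {σ : Deco} {n : ℕ} {E E' : Expr Value 0} {P Q : Proc Value 0} {q : List Msg}
      {U : Value} {T : Config}
      (hA : S.lookup A = some ⟨σ ++ [n], .cond E E' P Q, q⟩)
      (hE : evalList S [E, E'] = ([U, U], T)) :
      LStep prog A S (.step (σ ++ [n + 1])) (T.insert A ⟨σ ++ [n + 1], P, q⟩)
  | condNe {σ : Deco} {n : ℕ} {E E' : Expr Value 0} {P Q : Proc Value 0} {q : List Msg}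
      {U V : Value} {T : Config}
      (hA : S.lookup A = some ⟨σ ++ [n], .cond E E' P Q, q⟩)
      (hE : evalList S [E, E'] = ([U, V], T))
      (hne : U ≠ V) :
      LStep prog A S (.step (σ ++ [n + 1])) (T.insert A ⟨σ ++ [n + 1], Q, q⟩)
  | plusL {σ : Deco} {n : ℕ} {P Q : Proc Value 0} {q : List Msg}
      (hA : S.lookup A = some ⟨σ ++ [n], .plus P Q, q⟩) :
      LStep prog A S (.step (σ ++ [n + 1])) (S.insert A ⟨σ ++ [n + 1], P, q⟩)
  | plusR {σ : Deco} {n : ℕ} {P Q : Proc Value 0} {q : List Msg}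
      (hA : S.lookup A = some ⟨σ ++ [n], .plus P Q, q⟩) :
      LStep prog A S (.step (σ ++ [n + 1])) (S.insert A ⟨σ ++ [n + 1], Q, q⟩)

/-- The abstract transition relation, without labels. -/
def AbsStep (prog : Program) (S S' : Config) : Prop :=
  ∃ A α, LStep prog A S α S'

/-- The initial configuration: the root actor executes the main process. -/
def Program.init (prog : Program) : Config :=
  Finmap.singleton root ⟨[0], prog.main.map Value.var, []⟩

/-- The configurations of the abstract transition system of the program. -/
def Program.Reachable (prog : Program) (S : Config) : Prop :=
  Relation.ReflTransGen (AbsStep prog) prog.init S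

/-- No actor ever gets stuck: in every reachable configuration, each actor that has not
terminated its current process, or has a pending message, can perform a transition.
(An actor could get stuck only by invoking a variable, or by receiving
a message that its class does not define with that number of parameters.) -/
def Program.NonBlocking (prog : Program) : Prop :=
  ∀ S, prog.Reachable S → ∀ A a, S.lookup A = some a →
    (a.proc ≠ .nil ∨ a.queue ≠ []) → ∃ α S', LStep prog A S α S'

/-! ### The ordering -/

/-- The renaming `ρ`, which does not apply to the free variables of the main process. -/
def Program.rename (prog : Program) (ρ : Var → Value) (x : Var) : Value :=
  if x ∈ prog.main.names then .var x else ρ x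

/-- Renamings of the variables that are not free in the main process which
generate the same partition, agree on classes, and agree on
the free variables of the main process among their values. -/
def RenEquiv (prog : Program) (ρ ρ' : Var → Value) : Prop :=
  (∀ x ∉ prog.main.names, ∀ y ∉ prog.main.names, ρ x = ρ y ↔ ρ' x = ρ' y) ∧
  (∀ x ∉ prog.main.names, (ρ x).cls = (ρ' x).cls) ∧
  (∀ x ∉ prog.main.names,
    (∃ w ∈ prog.main.names, ρ x = .var w ∨ ρ' x = .var w) → ρ x = ρ' x)

/-- `Q` and `Q'` are `Pρ` and `Pρ'` for a process `P` without actor names. -/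
def ProcEquiv (prog : Program) (Q Q' : Proc Value 0) : Prop :=
  ∃ (P : Proc Var 0) (ρ ρ' : Var → Value), RenEquiv prog ρ ρ' ∧
    Q = P.map (prog.rename ρ) ∧ Q' = P.map (prog.rename ρ')

/-- The messages are renamings of one `m(x₁, …, xₖ, z)`, where `z` stands for the
target actor; the decorations are irrelevant. -/
def MsgEquiv (prog : Program) (μ μ' : Msg) : Prop :=
  μ.meth = μ'.meth ∧
  ∃ (xs : List Var) (z : Var) (ρ ρ' : Var → Value), RenEquiv prog ρ ρ' ∧
    μ.args = xs.map (prog.rename ρ) ∧ .actor μ.target = prog.rename ρ z ∧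
    μ'.args = xs.map (prog.rename ρ') ∧ .actor μ'.target = prog.rename ρ' z

/-- The embedding of queues: `q` is equivalent to a subsequence of `q'`, message by message. -/
def QueueLE (prog : Program) (q q' : List Msg) : Prop :=
  List.SublistForall₂ (MsgEquiv prog) q q'

/-- The embedding of configurations: distinct actors of `S` are mapped to distinct actors of `S'`
of the same class, with equivalent processes and larger queues. -/
def ConfigLE (prog : Program) (S S' : Config) : Prop :=
  ∃ f : ActorName → ActorName, Set.InjOn f {A | A ∈ S} ∧
    ∀ A a, S.lookup A = some a → (f A).cls = A.cls ∧
      ∃ a', S'.lookup (f A) = some a' ∧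
        ProcEquiv prog a.proc a'.proc ∧ QueueLE prog a.queue a'.queue

/-! ### Well-structured transition systems -/

/-- The transition system `(X, step)` with the relation `le` is well-structured. -/
structure IsWSTS {X : Type*} (step le : X → X → Prop) : Prop where
  finitely_branching : ∀ s, {s' | step s s'}.Finite
  refl : ∀ s, le s s
  trans : ∀ s t u, le s t → le t u → le s u
  wqo : WellQuasiOrdered le
  upward_compatible : ∀ s₁ s₁' s₂, le s₁ s₁' → step s₁ s₂ →
    ∃ s₂', Relation.ReflTransGen step s₁' s₂' ∧ le s₂ s₂'

end StatelessActor

end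

noncomputable section

namespace StatelessActor

/-! ### Renaming lemmas -/

section Map

variable {N N' N'' : Type} {n : ℕ}

/-! Both equivalences are kernels of invariants. A process is determined by its shape (free names
erased) and its list of free names. Up to admissible renaming, a list of values is determined by its
code: for each entry, its class, its identity if it is a free variable of the main process, and its
first position in the list. `procEquiv_iff` and `msgEquiv_iff` replace the existential definitions
by equality of codes.

Well-quasi-ordering: without state, every running process descends by finitely many syntactic steps
from the main process or a method body, so finitely many shapes, message arities and classes occur
(`nonempty_bounds`, `Bounds.good_of_reachable`). Hence there are finitely many codes. Higman's lemma
over this finite alphabet orders the queues (`partiallyWellOrderedOn_queueLE`); a second use, on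
lists of terms, orders the configurations (`wellQuasiOrdered_configLE`).

Upward compatibility (`Program.LEVia.exists_step`): a step of `A` is answered by its image `f A`. If
`A` runs a process, `f A` runs a renaming of it by some `θ` and makes the same step, `θ` being
extended to the actors that are created (`Sim.evalList`). The injection `f` and the renaming `θ`
need not agree: inexact delivery lets a message addressed to `θ A'` go to any actor of the right
class, in particular to the `f`-image of the original receiver. If `A` is idle and takes a message,
the matching message of `f A` may be preceded by others. Non-blocking lets `f A` consume those
first; each run ends because processes shrink, and meanwhile the other actors only gain messages at
the ends of their queues, which keeps the embedding (`exists_run_of_queue`,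
`Program.LEVia.exists_run_to_message`). -/

theorem Name.map_map (ρ : N → N') (ρ' : N' → N'') (a : Name N n) :
    (a.map ρ).map ρ' = a.map (ρ' ∘ ρ) := by
  cases a <;> rfl

theorem Expr.map_map (ρ : N → N') (ρ' : N' → N'') (E : Expr N n) :
    (E.map ρ).map ρ' = E.map (ρ' ∘ ρ) := by
  cases E <;> simp [Expr.map, Name.map_map]

theorem Proc.map_map (ρ : N → N') (ρ' : N' → N'') (P : Proc N n) :
    (P.map ρ).map ρ' = P.map (ρ' ∘ ρ) := by
  induction P <;> simp_all [Proc.map, Name.map_map, Expr.map_map]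

theorem Name.names_map (ρ : N → N') (a : Name N n) : (a.map ρ).names = a.names.map ρ := by
  cases a <;> rfl

theorem Expr.names_map (ρ : N → N') (E : Expr N n) : (E.map ρ).names = E.names.map ρ := by
  cases E <;> simp [Expr.map, Expr.names, Name.names_map]

theorem Proc.names_map (ρ : N → N') (P : Proc N n) : (P.map ρ).names = P.names.map ρ := by
  induction P <;>
    simp_all [Proc.map, Proc.names, Name.names_map, Expr.names_map, List.flatMap_map,
      List.map_flatMap]

theorem Name.map_congr {ρ ρ' : N → N'} (a : Name N n) (h : ∀ u ∈ a.names, ρ u = ρ' u) :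
    a.map ρ = a.map ρ' := by
  cases a <;> simp_all [Name.map, Name.names]

theorem Expr.map_congr {ρ ρ' : N → N'} (E : Expr N n) (h : ∀ u ∈ E.names, ρ u = ρ' u) :
    E.map ρ = E.map ρ' := by
  cases E with
  | name a => simp [Expr.map, Name.map_congr a h]
  | new C => rfl

theorem Proc.map_congr {ρ ρ' : N → N'} (P : Proc N n) (h : ∀ u ∈ P.names, ρ u = ρ' u) :
    P.map ρ = P.map ρ' := by
  induction P with
  | nil => rfl
  | letin E P ih =>
    simp only [Proc.names, List.mem_append] at h
    simp only [Proc.map]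
    rw [Expr.map_congr E fun u hu => h u (.inl hu), ih fun u hu => h u (.inr hu)]
  | send x m Es P ih =>
    simp only [Proc.names, List.mem_append, List.mem_flatMap] at h
    simp only [Proc.map]
    rw [Name.map_congr x fun u hu => h u (.inl (.inl hu)), ih fun u hu => h u (.inr hu),
      List.map_congr_left fun E hE => Expr.map_congr E fun u hu => h u (.inl (.inr ⟨E, hE, hu⟩))]
  | cond E E' P Q ihP ihQ =>
    simp only [Proc.names, List.mem_append] at h
    simp only [Proc.map]
    rw [Expr.map_congr E fun u hu => h u (.inl (.inl (.inl hu))),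
      Expr.map_congr E' fun u hu => h u (.inl (.inl (.inr hu))),
      ihP fun u hu => h u (.inl (.inr hu)), ihQ fun u hu => h u (.inr hu)]
  | plus P Q ihP ihQ =>
    simp only [Proc.names, List.mem_append] at h
    simp only [Proc.map]
    rw [ihP fun u hu => h u (.inl hu), ihQ fun u hu => h u (.inr hu)]

theorem Name.map_inst (ρ : N → N') (u : N) (a : Name N (n + 1)) :
    (a.inst u).map ρ = (a.map ρ).inst (ρ u) := by
  cases a with
  | free v => rfl
  | bound i => cases i using Fin.cases <;> rfl

theorem Expr.map_inst (ρ : N → N') (u : N) (E : Expr N (n + 1)) :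
    (E.inst u).map ρ = (E.map ρ).inst (ρ u) := by
  cases E <;> simp [Expr.map, Expr.inst, Name.map_inst]

theorem Proc.map_inst (ρ : N → N') (u : N) : {n : ℕ} → (P : Proc N (n + 1)) →
    (P.inst u).map ρ = (P.map ρ).inst (ρ u)
  | _, .nil => by simp [Proc.map, Proc.inst]
  | _, .letin E P => by simp [Proc.map, Proc.inst, Expr.map_inst, Proc.map_inst ρ u P]
  | _, .send x m Es P => by
    simp [Proc.map, Proc.inst, Name.map_inst, Expr.map_inst, Proc.map_inst ρ u P]
  | _, .cond E E' P Q => by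
    simp [Proc.map, Proc.inst, Expr.map_inst, Proc.map_inst ρ u P, Proc.map_inst ρ u Q]
  | _, .plus P Q => by simp [Proc.map, Proc.inst, Proc.map_inst ρ u P, Proc.map_inst ρ u Q]

theorem Name.mem_names_inst {u v : N} {a : Name N (n + 1)} (h : v ∈ (a.inst u).names) :
    v = u ∨ v ∈ a.names := by
  cases a with
  | free w => exact .inr h
  | bound i =>
    cases i using Fin.cases with
    | zero => simpa [Name.inst, Name.names] using h
    | succ i => simp [Name.inst, Name.names] at h

theorem Expr.mem_names_inst {u v : N} {E : Expr N (n + 1)} (h : v ∈ (E.inst u).names) :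
    v = u ∨ v ∈ E.names := by
  cases E with
  | name a => exact Name.mem_names_inst h
  | new C => simp [Expr.inst, Expr.names] at h

theorem Proc.mem_names_inst {u v : N} : {n : ℕ} → {P : Proc N (n + 1)} →
    v ∈ (P.inst u).names → v = u ∨ v ∈ P.names
  | _, .nil, h => by simp [Proc.inst, Proc.names] at h
  | _, .letin E P, h => by
    simp only [Proc.inst, Proc.names, List.mem_append] at h ⊢
    rcases h with h | h
    · have := Expr.mem_names_inst h; tauto
    · have := Proc.mem_names_inst h; tauto
  | _, .send x m Es P, h => by
    simp only [Proc.inst, Proc.names, List.mem_append, List.mem_flatMap, List.mem_map] at h ⊢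
    rcases h with (h | ⟨_, ⟨E, hE, rfl⟩, h⟩) | h
    · have := Name.mem_names_inst h; tauto
    · have := Expr.mem_names_inst h
      rcases this with h | h
      · exact .inl h
      · exact .inr (.inl (.inr ⟨E, hE, h⟩))
    · have := Proc.mem_names_inst h; tauto
  | _, .cond E E' P Q, h => by
    simp only [Proc.inst, Proc.names, List.mem_append] at h ⊢
    rcases h with ((h | h) | h) | h
    · have := Expr.mem_names_inst h; tauto
    · have := Expr.mem_names_inst h; tauto
    · have := Proc.mem_names_inst h; tauto
    · have := Proc.mem_names_inst h; tauto
  | _, .plus P Q, h => by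
    simp only [Proc.inst, Proc.names, List.mem_append] at h ⊢
    rcases h with h | h
    · have := Proc.mem_names_inst h; tauto
    · have := Proc.mem_names_inst h; tauto

/-- The number of constructors of a process. -/
def Proc.size : {n : ℕ} → Proc N n → ℕ
  | _, .nil => 0
  | _, .letin _ P => P.size + 1
  | _, .send _ _ _ P => P.size + 1
  | _, .cond _ _ P Q => P.size + Q.size + 1
  | _, .plus P Q => P.size + Q.size + 1

theorem Proc.size_inst (u : N) : {n : ℕ} → (P : Proc N (n + 1)) → (P.inst u).size = P.size
  | _, .nil => by simp [Proc.size, Proc.inst]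
  | _, .letin E P => by simp [Proc.size, Proc.inst, Proc.size_inst u P]
  | _, .send x m Es P => by simp [Proc.size, Proc.inst, Proc.size_inst u P]
  | _, .cond E E' P Q => by simp [Proc.size, Proc.inst, Proc.size_inst u P, Proc.size_inst u Q]
  | _, .plus P Q => by simp [Proc.size, Proc.inst, Proc.size_inst u P, Proc.size_inst u Q]

end Map

/-! ### Shapes: processes whose free names are erased -/

section Shape

variable {N : Type} {n : ℕ}

/-- The process with its free names erased. -/
def Proc.shape (P : Proc N n) : Proc Unit n := P.map fun _ => ()

theorem Proc.shape_map {N' : Type} (ρ : N → N') (P : Proc N n) : (P.map ρ).shape = P.shape :=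
  Proc.map_map _ _ _

theorem Name.eq_of_erase {a b : Name N n} (h : a.map (fun _ => ()) = b.map fun _ => ())
    (hn : a.names = b.names) : a = b := by
  cases a <;> cases b <;> simp_all [Name.map, Name.names]

/-- This and its analogues below allow an equality of concatenated name lists to be split at the
boundaries between subterms. -/
theorem Name.length_names_of_erase {a b : Name N n}
    (h : a.map (fun _ => ()) = b.map fun _ => ()) : a.names.length = b.names.length := by
  have := congrArg (fun a => a.names.length) h
  simpa [Name.names_map] using this

theorem Expr.length_names_of_erase {a b : Expr N n}
    (h : a.map (fun _ => ()) = b.map fun _ => ()) : a.names.length = b.names.length := by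
  have := congrArg (fun a => a.names.length) h
  simpa [Expr.names_map] using this

theorem Proc.length_names_of_shape {a b : Proc N n}
    (h : a.shape = b.shape) : a.names.length = b.names.length := by
  have := congrArg (fun a => a.names.length) h
  simpa [Proc.shape, Proc.names_map] using this

theorem Expr.eq_of_erase {a b : Expr N n} (h : a.map (fun _ => ()) = b.map fun _ => ())
    (hn : a.names = b.names) : a = b := by
  cases a <;> cases b <;> simp_all [Expr.map, Expr.names]
  exact Name.eq_of_erase h hn

theorem Expr.list_eq_of_erase : {l l' : List (Expr N n)} →
    l.map (Expr.map fun _ => ()) = l'.map (Expr.map fun _ => ()) →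
    l.flatMap Expr.names = l'.flatMap Expr.names → l = l'
  | [], [], _, _ => rfl
  | [], _ :: _, h, _ => by simp at h
  | _ :: _, [], h, _ => by simp at h
  | E :: l, E' :: l', h, hn => by
    simp only [List.map_cons, List.cons.injEq] at h
    simp only [List.flatMap_cons] at hn
    obtain ⟨h₁, h₂⟩ := List.append_inj hn (Expr.length_names_of_erase h.1)
    rw [Expr.eq_of_erase h.1 h₁, Expr.list_eq_of_erase h.2 h₂]

theorem Expr.length_flatMap_names_of_erase {l l' : List (Expr N n)}
    (h : l.map (Expr.map fun _ => ()) = l'.map (Expr.map fun _ => ())) :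
    (l.flatMap Expr.names).length = (l'.flatMap Expr.names).length := by
  have := congrArg (fun l => (List.map (fun a => a.names.length) l).sum) h
  simpa [Expr.names_map, List.length_flatMap, Function.comp_def] using this

/-- The shape fixes how many names each subterm contributes, so the list of names can be distributed
back to the subterms in only one way. -/
theorem Proc.eq_of_shape : {n : ℕ} → {P Q : Proc N n} → P.shape = Q.shape →
    P.names = Q.names → P = Q
  | _, .nil, Q, h, hn => by cases Q <;> simp_all [Proc.shape, Proc.map]
  | _, .letin E P, Q, h, hn => by
    cases Q <;> simp only [Proc.shape, Proc.map, reduceCtorEq, Proc.letin.injEq] at h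
    obtain ⟨h₁, h₂⟩ := List.append_inj hn (Expr.length_names_of_erase h.1)
    rw [Expr.eq_of_erase h.1 h₁, Proc.eq_of_shape h.2 h₂]
  | _, .send x m Es P, Q, h, hn => by
    cases Q <;> simp only [Proc.shape, Proc.map, reduceCtorEq, Proc.send.injEq] at h
    obtain ⟨hx, rfl, hE, hP⟩ := h
    simp only [Proc.names, List.append_assoc] at hn
    obtain ⟨h₁, h₂⟩ := List.append_inj hn (Name.length_names_of_erase hx)
    obtain ⟨h₂, h₃⟩ := List.append_inj h₂ (Expr.length_flatMap_names_of_erase hE)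
    rw [Name.eq_of_erase hx h₁, Expr.list_eq_of_erase hE h₂, Proc.eq_of_shape hP h₃]
  | _, .cond E E' P P', Q, h, hn => by
    cases Q <;> simp only [Proc.shape, Proc.map, reduceCtorEq, Proc.cond.injEq] at h
    obtain ⟨hE, hE', hP, hP'⟩ := h
    simp only [Proc.names, List.append_assoc] at hn
    obtain ⟨h₁, h₂⟩ := List.append_inj hn (Expr.length_names_of_erase hE)
    obtain ⟨h₂, h₃⟩ := List.append_inj h₂ (Expr.length_names_of_erase hE')
    obtain ⟨h₃, h₄⟩ := List.append_inj h₃ (Proc.length_names_of_shape hP)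
    rw [Expr.eq_of_erase hE h₁, Expr.eq_of_erase hE' h₂, Proc.eq_of_shape hP h₃,
      Proc.eq_of_shape hP' h₄]
  | _, .plus P P', Q, h, hn => by
    cases Q <;> simp only [Proc.shape, Proc.map, reduceCtorEq, Proc.plus.injEq] at h
    obtain ⟨h₁, h₂⟩ := List.append_inj hn (Proc.length_names_of_shape h.1)
    rw [Proc.eq_of_shape h.1 h₁, Proc.eq_of_shape h.2 h₂]

end Shape

/-! ### Codes: tuples of values up to renaming -/

/-- The class of a value, together with its name if it is free in the main process. -/
def Program.kind (prog : Program) : Value → Option (Option ClassName) × Option Var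
  | .var x => (none, if x ∈ prog.main.names then some x else none)
  | .actor A => (some A.cls, none)

/-- The tuple with each value replaced by its kind and its first position. -/
def Program.code (prog : Program) (L : List Value) :
    List ((Option (Option ClassName) × Option Var) × ℕ) :=
  L.map fun u => (prog.kind u, L.idxOf u)

/-- `θ` is an admissible renaming of the values in `X`. -/
def Program.IsoOn (prog : Program) (X : Set Value) (θ : Value → Value) : Prop :=
  Set.InjOn θ X ∧ ∀ u ∈ X, prog.kind (θ u) = prog.kind u

section Code

variable {prog : Program}

theorem kind_fst (u : Value) : (prog.kind u).1 = u.cls := by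
  cases u <;> rfl

theorem kind_snd_eq_some {u : Value} {w : Var} :
    (prog.kind u).2 = some w ↔ w ∈ prog.main.names ∧ u = .var w := by
  cases u with
  | var x =>
    simp only [Program.kind, Value.var.injEq]
    split_ifs with h <;> aesop
  | actor A => simp [Program.kind]

/-- The right-hand side is the pointwise part of `RenEquiv`, so equality of kinds replaces its last
two clauses. -/
theorem kind_eq_iff {u v : Value} : prog.kind u = prog.kind v ↔
    u.cls = v.cls ∧ ((∃ w ∈ prog.main.names, u = .var w ∨ v = .var w) → u = v) := by
  rw [Prod.ext_iff, kind_fst, kind_fst]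
  refine and_congr_right fun _ => ⟨?_, fun h => ?_⟩
  · rintro h ⟨w, hw, rfl | rfl⟩
    · exact (kind_snd_eq_some.1 (h ▸ kind_snd_eq_some.2 ⟨hw, rfl⟩)).2.symm
    · exact (kind_snd_eq_some.1 (h ▸ kind_snd_eq_some.2 ⟨hw, rfl⟩)).2
  · ext w
    rw [kind_snd_eq_some, kind_snd_eq_some]
    constructor
    · rintro ⟨hw, rfl⟩
      exact ⟨hw, (h ⟨w, hw, .inl rfl⟩).symm⟩
    · rintro ⟨hw, rfl⟩
      exact ⟨hw, h ⟨w, hw, .inr rfl⟩⟩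

theorem eq_actor_of_kind_eq {u : Value} {A : ActorName}
    (h : prog.kind u = prog.kind (.actor A)) : ∃ B, u = .actor B ∧ B.cls = A.cls := by
  cases u with
  | var x => simp [Program.kind] at h
  | actor B => exact ⟨B, rfl, by simpa [Program.kind] using h⟩

theorem idxOf_map_eq {α : Type*} {r r' : α → Value} : (xs : List α) → (x : α) →
    (∀ y ∈ xs, r x = r y ↔ r' x = r' y) → (xs.map r).idxOf (r x) = (xs.map r').idxOf (r' x)
  | [], _, _ => rfl
  | y :: xs, x, h => by
    have ih := idxOf_map_eq xs x fun z hz => h z (List.mem_cons_of_mem _ hz)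
    simp only [List.map_cons, List.idxOf_cons, ih]
    have := h y List.mem_cons_self
    by_cases hxy : r y = r x
    · rw [beq_iff_eq.2 hxy, beq_iff_eq.2 (this.1 hxy.symm).symm]
    · rw [beq_eq_false_iff_ne.2 hxy, beq_eq_false_iff_ne.2 fun h' => hxy (this.2 h'.symm).symm]

theorem code_map_eq {α : Type*} {r r' : α → Value} (xs : List α)
    (h : ∀ x ∈ xs, ∀ y ∈ xs, r x = r y ↔ r' x = r' y)
    (hk : ∀ x ∈ xs, prog.kind (r x) = prog.kind (r' x)) :
    prog.code (xs.map r) = prog.code (xs.map r') := by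
  simp only [Program.code, List.map_map]
  refine List.map_congr_left fun x hx => ?_
  simp only [Function.comp, hk x hx, idxOf_map_eq xs x (h x hx)]

theorem code_map_of_isoOn {L : List Value} {θ : Value → Value}
    (h : prog.IsoOn {u | u ∈ L} θ) : prog.code L = prog.code (L.map θ) := by
  conv_lhs => rw [← List.map_id L]
  exact code_map_eq L (fun x hx y hy => (h.1.eq_iff hx hy).symm) fun x hx => (h.2 x hx).symm

theorem length_eq_of_code {L L' : List Value} (h : prog.code L = prog.code L') :
    L.length = L'.length := by
  simpa [Program.code] using congrArg List.length h

/-- First positions record the equality pattern of a list; two lists with the same pattern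
correspond entry by entry under an injective map. -/
theorem exists_isoOn_of_code {L L' : List Value} (h : prog.code L = prog.code L') :
    ∃ θ, prog.IsoOn {u | u ∈ L} θ ∧ L' = L.map θ := by
  have hlen := length_eq_of_code h
  have key : ∀ i (hi : i < L.length) (hi' : i < L'.length),
      prog.kind L[i] = prog.kind L'[i] ∧ L.idxOf L[i] = L'.idxOf L'[i] := by
    intro i hi hi'
    have := congrArg (fun l => l[i]?) h
    simpa [Program.code, hi, hi'] using this
  have hθ : ∀ i (hi : i < L.length) (hi' : i < L'.length),
      L'.getD (L.idxOf L[i]) L[i] = L'[i] := by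
    intro i hi hi'
    rw [(key i hi hi').2, List.getD_eq_getElem _ _ (List.idxOf_lt_length_of_mem
      (List.getElem_mem hi'))]
    exact List.getElem_idxOf _
  -- A value goes to the entry of `L'` at its first position in `L`; the default is never reached on
  -- `L`.
  refine ⟨fun u => L'.getD (L.idxOf u) u, ⟨?_, ?_⟩, ?_⟩
  · intro u hu v hv huv
    obtain ⟨i, hi, rfl⟩ := List.getElem_of_mem hu
    obtain ⟨j, hj, rfl⟩ := List.getElem_of_mem hv
    simp only [hθ i hi (hlen ▸ hi), hθ j hj (hlen ▸ hj)] at huv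
    have h₁ := (key i hi (hlen ▸ hi)).2
    rw [huv, ← (key j hj (hlen ▸ hj)).2] at h₁
    exact (List.idxOf_inj hu).1 h₁
  · intro u hu
    obtain ⟨i, hi, rfl⟩ := List.getElem_of_mem hu
    simp only [hθ i hi (hlen ▸ hi)]
    exact (key i hi _).1.symm
  · refine List.ext_getElem (by simp [hlen]) fun i hi hi' => ?_
    rw [List.getElem_map]
    exact (hθ i (hlen ▸ hi) hi).symm

theorem Program.IsoOn.mono {X Y : Set Value} {θ : Value → Value} (h : prog.IsoOn Y θ)
    (hXY : X ⊆ Y) : prog.IsoOn X θ :=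
  ⟨h.1.mono hXY, fun u hu => h.2 u (hXY hu)⟩

theorem Program.IsoOn.congr {X : Set Value} {θ θ' : Value → Value} (h : prog.IsoOn X θ)
    (hθ : Set.EqOn θ' θ X) : prog.IsoOn X θ' :=
  ⟨h.1.congr hθ.symm, fun u hu => by rw [hθ hu, h.2 u hu]⟩

/-- Admissible renamings extend to injective families of new values. -/
theorem Program.IsoOn.extend {X : Set Value} {θ : Value → Value} (h : prog.IsoOn X θ)
    {ι : Type*} {g g' : ι → Value} (hg : g.Injective) (hg' : g'.Injective)
    (hX : ∀ i, g i ∉ X) (hX' : ∀ i, g' i ∉ θ '' X)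
    (hk : ∀ i, prog.kind (g i) = prog.kind (g' i)) :
    ∃ θ', Set.EqOn θ' θ X ∧ (∀ i, θ' (g i) = g' i) ∧ prog.IsoOn (X ∪ Set.range g) θ' := by
  classical
  refine ⟨fun u => if hu : ∃ i, g i = u then g' hu.choose else θ u, ?_⟩
  have h₁ : ∀ u ∈ X, ¬ ∃ i, g i = u := by
    rintro _ hu ⟨i, rfl⟩
    exact hX i hu
  have h₂ : ∀ i (hi : ∃ j, g j = g i), g' hi.choose = g' i := fun i hi => by
    rw [hg hi.choose_spec]
  refine ⟨fun u hu => dif_neg (h₁ u hu), fun i => ?_, ?_, ?_⟩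
  · have hi : ∃ j, g j = g i := ⟨i, rfl⟩
    simp only [dif_pos hi, h₂]
  · rintro u (hu | ⟨i, rfl⟩) v (hv | ⟨j, rfl⟩) huv
    · simp only [dif_neg (h₁ u hu), dif_neg (h₁ v hv)] at huv
      exact h.1 hu hv huv
    · have hj : ∃ k, g k = g j := ⟨j, rfl⟩
      simp only [dif_neg (h₁ u hu), dif_pos hj, h₂] at huv
      exact (hX' j ⟨u, hu, huv⟩).elim
    · have hj : ∃ k, g k = g i := ⟨i, rfl⟩
      simp only [dif_neg (h₁ v hv), dif_pos hj, h₂] at huv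
      exact (hX' i ⟨v, hv, huv.symm⟩).elim
    · have hi : ∃ k, g k = g i := ⟨i, rfl⟩
      have hj : ∃ k, g k = g j := ⟨j, rfl⟩
      simp only [dif_pos hi, dif_pos hj, h₂] at huv
      rw [hg' huv]
  · rintro u (hu | ⟨i, rfl⟩)
    · simp only [dif_neg (h₁ u hu), h.2 u hu]
    · have hi : ∃ k, g k = g i := ⟨i, rfl⟩
      simp only [dif_pos hi, h₂, hk]

/-! ### Characterizations of the equivalences -/

theorem kind_rename_eq {ρ ρ' : Var → Value} (h : RenEquiv prog ρ ρ') (x : Var) :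
    prog.kind (prog.rename ρ x) = prog.kind (prog.rename ρ' x) := by
  unfold Program.rename
  split_ifs with hx
  · rfl
  · exact kind_eq_iff.2 ⟨h.2.1 x hx, h.2.2 x hx⟩

theorem RenEquiv.symm {ρ ρ' : Var → Value} (h : RenEquiv prog ρ ρ') : RenEquiv prog ρ' ρ :=
  ⟨fun x hx y hy => (h.1 x hx y hy).symm, fun x hx => (h.2.1 x hx).symm,
    fun x hx ⟨w, hw, hxw⟩ => (h.2.2 x hx ⟨w, hw, hxw.symm⟩).symm⟩

/-- `RenEquiv` compares only renamable variables. When a renamable variable is identified with a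
free variable of the main process, its last clause forces the same identification on the other side.
-/
theorem rename_eq_rename {ρ ρ' : Var → Value} (h : RenEquiv prog ρ ρ') {x y : Var}
    (hxy : prog.rename ρ x = prog.rename ρ y) : prog.rename ρ' x = prog.rename ρ' y := by
  unfold Program.rename at *
  split_ifs at * with hx hy hy
  · exact hxy
  · rw [hxy]; exact h.2.2 y hy ⟨x, hx, .inl hxy.symm⟩
  · rw [← hxy]; exact (h.2.2 x hx ⟨y, hy, .inl hxy⟩).symm
  · exact (h.1 x hx y hy).1 hxy

theorem code_rename_eq {ρ ρ' : Var → Value} (h : RenEquiv prog ρ ρ') (xs : List Var) :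
    prog.code (xs.map (prog.rename ρ)) = prog.code (xs.map (prog.rename ρ')) :=
  code_map_eq xs (fun _ _ _ _ => ⟨rename_eq_rename h, rename_eq_rename h.symm⟩)
    fun x _ => kind_rename_eq h x

/-- Supplies the common source term demanded by the definitions of equivalence: `e` abstracts each
value to a variable, `ρ` restores it, and `ρ'` yields its image. Free variables of the main process
stand for themselves, which is consistent because `θ` preserves kinds and so fixes them. -/
theorem exists_renEquiv {L : List Value} {θ : Value → Value} (h : prog.IsoOn {u | u ∈ L} θ) :
    ∃ (e : Value → Var) (ρ ρ' : Var → Value), RenEquiv prog ρ ρ' ∧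
      ∀ u ∈ L, prog.rename ρ (e u) = u ∧ prog.rename ρ' (e u) = θ u := by
  -- A head element is needed as the default value below.
  rcases L with _ | ⟨u₀, L'⟩
  · exact ⟨fun _ => 0, fun _ => .var 0, fun _ => .var 0, by simp [RenEquiv], by simp⟩
  set L := u₀ :: L' with hL
  obtain ⟨m, hm⟩ : ∃ m, ∀ x, m ≤ x → x ∉ prog.main.names := by
    obtain ⟨m, hm⟩ := prog.main.names.toFinset.bddAbove
    exact ⟨m + 1, fun x hx hx' => by
      exact Nat.not_succ_le_self m (hx.trans (hm (by simpa using hx')))⟩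
  have hρ : ∀ x, L.getD (x - m) u₀ ∈ L := by
    intro x
    by_cases hx : x - m < L.length
    · rw [List.getD_eq_getElem _ _ hx]; exact List.getElem_mem hx
    · rw [List.getD_eq_default _ _ (not_lt.1 hx)]; exact List.mem_cons_self
  -- The shift by `m` avoids the free variables of the main process. With default `u₀`, the values
  -- of `ρ` all lie in `L`, so injectivity and kind preservation of `θ` give `RenEquiv` at every
  -- variable, used or not.
  refine ⟨fun u => (prog.kind u).2.getD (m + L.idxOf u), fun x => L.getD (x - m) u₀, fun x => θ (L.getD (x - m) u₀),
    ⟨?_, ?_, ?_⟩, ?_⟩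
  · exact fun x _ y _ => (h.1.eq_iff (hρ x) (hρ y)).symm
  · exact fun x _ => (kind_eq_iff.1 (h.2 _ (hρ x)).symm).1
  · exact fun x _ => (kind_eq_iff.1 (h.2 _ (hρ x)).symm).2
  · intro u hu
    cases hk : (prog.kind u).2 with
    | some w =>
      obtain ⟨hw, rfl⟩ := kind_snd_eq_some.1 hk
      simp only [Program.rename, hk, Option.getD_some, if_pos hw, true_and]
      exact ((kind_eq_iff.1 (h.2 _ hu)).2 ⟨w, hw, .inr rfl⟩).symm
    | none =>
      have : L.getD (L.idxOf u) u₀ = u := by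
        rw [List.getD_eq_getElem _ _ (List.idxOf_lt_length_of_mem hu)]
        exact List.getElem_idxOf _
      simp only [Program.rename, hk, Option.getD_none, if_neg (hm _ (Nat.le_add_right m _)),
        Nat.add_sub_cancel_left, this, and_self]

/-- A complete invariant of processes up to equivalence. -/
def Program.procCode (prog : Program) (P : Proc Value 0) :
    Proc Unit 0 × List ((Option (Option ClassName) × Option Var) × ℕ) :=
  (P.shape, prog.code P.names)

/-- A complete invariant of messages up to equivalence. -/
def Program.msgCode (prog : Program) (μ : Msg) :
    MethName × List ((Option (Option ClassName) × Option Var) × ℕ) :=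
  (μ.meth, prog.code (.actor μ.target :: μ.args))

theorem exists_isoOn_of_procCode {P Q : Proc Value 0} (h : prog.procCode P = prog.procCode Q) :
    ∃ θ, prog.IsoOn {u | u ∈ P.names} θ ∧ Q = P.map θ := by
  obtain ⟨hs, hc⟩ := Prod.ext_iff.1 h
  obtain ⟨θ, hθ, hL⟩ := exists_isoOn_of_code hc
  exact ⟨θ, hθ, Proc.eq_of_shape (by rw [Proc.shape_map]; exact hs.symm)
    (by rw [Proc.names_map, hL])⟩

theorem procCode_map {P : Proc Value 0} {θ : Value → Value}
    (h : prog.IsoOn {u | u ∈ P.names} θ) : prog.procCode P = prog.procCode (P.map θ) := by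
  simp only [Program.procCode, Proc.shape_map, Proc.names_map, ← code_map_of_isoOn h]

theorem procEquiv_iff {P Q : Proc Value 0} :
    ProcEquiv prog P Q ↔ prog.procCode P = prog.procCode Q := by
  constructor
  · rintro ⟨R, ρ, ρ', h, rfl, rfl⟩
    simp only [Program.procCode, Proc.shape_map, Proc.names_map, code_rename_eq h]
  · intro h
    obtain ⟨θ, hθ, rfl⟩ := exists_isoOn_of_procCode h
    obtain ⟨e, ρ, ρ', hρ, he⟩ := exists_renEquiv hθ
    refine ⟨P.map e, ρ, ρ', hρ, ?_, ?_⟩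
    · rw [Proc.map_map]
      refine Eq.trans ?_ (Proc.map_congr (ρ := id) P fun u hu => (he u hu).1.symm)
      exact Proc.eq_of_shape (Proc.shape_map id P).symm (by rw [Proc.names_map, List.map_id])
    · rw [Proc.map_map]
      exact Proc.map_congr P fun u hu => (he u hu).2.symm

theorem msgEquiv_iff {μ μ' : Msg} : MsgEquiv prog μ μ' ↔ prog.msgCode μ = prog.msgCode μ' := by
  simp only [MsgEquiv, Program.msgCode, Prod.mk.injEq]
  refine and_congr_right fun _ => ⟨?_, fun h => ?_⟩
  · rintro ⟨xs, z, ρ, ρ', h, h₁, h₂, h₃, h₄⟩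
    rw [h₁, h₂, h₃, h₄, ← List.map_cons, ← List.map_cons, code_rename_eq h]
  · obtain ⟨θ, hθ, hL⟩ := exists_isoOn_of_code h
    rw [List.map_cons, List.cons.injEq] at hL
    obtain ⟨e, ρ, ρ', hρ, he⟩ := exists_renEquiv hθ
    refine ⟨μ.args.map e, e (.actor μ.target), ρ, ρ', hρ, ?_,
      (he _ List.mem_cons_self).1.symm, ?_, hL.1.trans (he _ List.mem_cons_self).2.symm⟩
    · rw [List.map_map]
      conv_lhs => rw [← List.map_id μ.args]
      exact List.map_congr_left fun u hu => (he u (List.mem_cons_of_mem _ hu)).1.symm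
    · rw [List.map_map, hL.2]
      exact List.map_congr_left fun u hu => (he u (List.mem_cons_of_mem _ hu)).2.symm

/-- Equality of message codes, embedded in queues. -/
theorem queueLE_iff {q q' : List Msg} : QueueLE prog q q' ↔
    List.SublistForall₂ (fun μ μ' => prog.msgCode μ = prog.msgCode μ') q q' := by
  unfold QueueLE
  rw [show MsgEquiv prog = fun μ μ' => prog.msgCode μ = prog.msgCode μ' from
    funext₂ fun _ _ => propext msgEquiv_iff]

end Code

/-! ### Occurrences, freshness and evaluation -/

section Eval

variable {prog : Program} {S T : Config}

theorem lookup_insert_eq (A B : ActorName) (a : ActorState) (S : Config) :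
    (S.insert A a).lookup B = if B = A then some a else S.lookup B := by
  split_ifs with h
  · subst h; exact Finmap.lookup_insert S
  · exact Finmap.lookup_insert_of_ne S h

theorem occurs_finite (S : Config) : {u | Occurs u S}.Finite := by
  have h : {u | Occurs u S} ⊆ ⋃ A ∈ S.keys, {u | ∃ a, S.lookup A = some a ∧
      (u = .actor A ∨ u ∈ a.proc.names ∨ ∃ μ ∈ a.queue, u ∈ μ.args ∨ u = .actor μ.target)} := by
    rintro u ⟨A, a, hA, hu⟩
    exact Set.mem_biUnion (Finmap.mem_keys.2 (Finmap.mem_of_lookup_eq_some hA)) ⟨a, hA, hu⟩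
  refine (Set.Finite.biUnion (Finset.finite_toSet _) fun A _ => ?_).subset h
  rcases hA : S.lookup A with _ | a
  · simp
  · refine (((List.finite_toSet (.actor A :: a.proc.names ++
      a.queue.flatMap fun μ => .actor μ.target :: μ.args))).subset ?_)
    rintro u ⟨b, hb, hu⟩
    obtain rfl := Option.some.inj hb
    simp only [List.cons_append, List.mem_cons, List.mem_append, List.mem_flatMap,
      Set.mem_ofPred_eq]
    rcases hu with hu | hu | ⟨μ, hμ, hu⟩
    · exact .inl hu
    · exact .inr (.inl hu)
    · exact .inr (.inr ⟨μ, hμ, hu.symm⟩)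

theorem not_occurs_freshActor (S : Config) (C : ClassName) :
    ¬ Occurs (.actor (freshActor S C)) S := by
  have : {i | ¬ Occurs (.actor ⟨some C, i⟩) S}.Nonempty := by
    have hfin : {i : ℕ | Occurs (.actor ⟨some C, i⟩) S}.Finite :=
      (occurs_finite S).preimage (f := fun i : ℕ => Value.actor ⟨some C, i⟩)
        fun i _ j _ h => by simpa using h
    exact hfin.infinite_compl.nonempty
  exact Nat.sInf_mem this

theorem occurs_of_lookup {A : ActorName} {a : ActorState} (h : S.lookup A = some a) :
    Occurs (.actor A) S :=
  ⟨A, a, h, .inl rfl⟩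

theorem freshActor_notMem (S : Config) (C : ClassName) : freshActor S C ∉ S := fun h => by
  obtain ⟨a, ha⟩ := Finmap.mem_iff.1 h
  exact not_occurs_freshActor S C (occurs_of_lookup ha)

theorem infinite_freshVar (prog : Program) (S : Config) :
    {x : Var | x ∉ prog.main.names ∧ ¬ Occurs (.var x) S}.Infinite := by
  have h₁ : {x : Var | Occurs (.var x) S}.Finite :=
    (occurs_finite S).preimage (f := Value.var) fun i _ j _ h => by simpa using h
  have h₂ : {x : Var | x ∈ prog.main.names}.Finite := List.finite_toSet _
  refine (h₂.union h₁).infinite_compl.mono fun x hx => ?_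
  simpa [not_or] using hx

theorem freshVar_spec (prog : Program) (S : Config) (i : ℕ) :
    freshVar prog S i ∉ prog.main.names ∧ ¬ Occurs (.var (freshVar prog S i)) S :=
  Nat.nth_mem_of_infinite (infinite_freshVar prog S) i

theorem freshVar_injective (prog : Program) (S : Config) : (freshVar prog S).Injective :=
  Nat.nth_injective (infinite_freshVar prog S)

/-- `T` is obtained from `S` by adding idle actors. -/
def AddsIdle (S T : Config) : Prop :=
  ∀ A, T.lookup A = S.lookup A ∨ S.lookup A = none ∧ T.lookup A = some ⟨[], .nil, []⟩

theorem addsIdle_insert {A : ActorName} (h : A ∉ S) :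
    AddsIdle S (S.insert A ⟨[], .nil, []⟩) := fun B => by
  by_cases hB : B = A
  · subst hB
    exact .inr ⟨Finmap.lookup_eq_none.2 h, Finmap.lookup_insert S⟩
  · exact .inl (Finmap.lookup_insert_of_ne S hB)

theorem evalOne_addsIdle (S : Config) (E : Expr Value 0) : AddsIdle S (evalOne S E).2 := by
  rcases E with (u | i) | C
  · exact fun _ => .inl rfl
  · exact i.elim0
  · exact addsIdle_insert (freshActor_notMem S C)

theorem AddsIdle.trans {S T T' : Config} (h : AddsIdle S T) (h' : AddsIdle T T') :
    AddsIdle S T' := fun A => by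
  rcases h A with h | ⟨h, hT⟩
  · rw [← h]; exact h' A
  · rcases h' A with h' | ⟨h', -⟩
    · exact .inr ⟨h, h'.trans hT⟩
    · rw [hT] at h'; cases h'

theorem evalList_addsIdle : (Es : List (Expr Value 0)) → (S : Config) →
    AddsIdle S (evalList S Es).2
  | [], _ => fun _ => .inl rfl
  | E :: Es, S => (evalOne_addsIdle S E).trans (evalList_addsIdle Es _)

theorem AddsIdle.lookup_eq (h : AddsIdle S T) {A : ActorName} {a : ActorState}
    (hA : S.lookup A = some a) : T.lookup A = some a := by
  rcases h A with h | ⟨h, -⟩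
  · rw [h, hA]
  · rw [h] at hA; cases hA

theorem AddsIdle.occurs (h : AddsIdle S T) {u : Value} (hu : Occurs u S) : Occurs u T := by
  obtain ⟨A, a, hA, hu⟩ := hu
  exact ⟨A, a, h.lookup_eq hA, hu⟩

theorem length_evalList : (Es : List (Expr Value 0)) → (S : Config) →
    (evalList S Es).1.length = Es.length
  | [], _ => rfl
  | _ :: Es, _ => congrArg (· + 1) (length_evalList Es _)

theorem evalList_singleton (S : Config) (E : Expr Value 0) :
    evalList S [E] = ([(evalOne S E).1], (evalOne S E).2) := rfl

end Eval

/-! ### Finite branching -/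

/-- The decoration after one more step. -/
def bump (δ : Deco) : Deco := δ.dropLast ++ [δ.getLastD 0 + 1]

theorem bump_append (σ : Deco) (n : ℕ) : bump (σ ++ [n]) = σ ++ [n + 1] := by
  simp [bump]

/-- A set that contains all the configurations reachable by one step of the actor `A`
in the given state. -/
def successors (prog : Program) (A : ActorName) (S : Config) : ActorState → Set Config
  | ⟨_, .nil, []⟩ => ∅
  | ⟨_, .nil, μ :: q⟩ => (fun d => S.insert A ⟨μ.deco ++ [0], d.instantiate prog S μ.target μ.args,
      q⟩) '' {d | ∃ C, A.cls = some C ∧ prog.defs C μ.meth = some d}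
  | ⟨δ, .letin E P, q⟩ => {(evalOne S E).2.insert A ⟨bump δ, P.inst (evalOne S E).1, q⟩}
  | ⟨δ, .plus P Q, q⟩ => {S.insert A ⟨bump δ, P, q⟩, S.insert A ⟨bump δ, Q, q⟩}
  | ⟨δ, .cond E E' P Q, q⟩ => {(evalList S [E, E']).2.insert A ⟨bump δ, P, q⟩,
      (evalList S [E, E']).2.insert A ⟨bump δ, Q, q⟩}
  | ⟨_, .send (.bound _) _ _ _, _⟩ => ∅
  | ⟨_, .send (.free (.var _)) _ _ _, _⟩ => ∅
  | ⟨δ, .send (.free (.actor A')) m Es P, q⟩ =>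
      insert ((evalList S Es).2.insert A ⟨bump δ, P, q ++ [⟨m, (evalList S Es).1, bump δ, A'⟩]⟩)
        (⋃ B ∈ S.keys, (fun b : ActorState =>
          ((evalList S Es).2.insert A ⟨bump δ, P, q⟩).insert B ⟨b.deco, b.proc,
            b.queue ++ [⟨m, (evalList S Es).1, bump δ, A'⟩]⟩) '' {b | S.lookup B = some b})

theorem finite_successors (prog : Program) (A : ActorName) (S : Config) (a : ActorState) :
    (successors prog A S a).Finite := by
  unfold successors
  split
  · exact Set.finite_empty
  -- The class of `A` and the method name determine the definition.
  · refine (Set.Subsingleton.finite ?_).image _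
    rintro d ⟨C, hC, hd⟩ d' ⟨C', hC', hd'⟩
    cases hC.symm.trans hC'
    exact Option.some.inj (hd.symm.trans hd')
  · exact Set.toFinite _
  · exact Set.toFinite _
  · exact Set.toFinite _
  · exact Set.finite_empty
  · exact Set.finite_empty
  · refine Set.Finite.insert _ (Set.Finite.biUnion (Finset.finite_toSet _) fun B _ => ?_)
    refine (Set.Subsingleton.finite ?_).image _
    intro b hb b' hb'
    exact Option.some.inj (Eq.trans (Eq.symm hb) hb')

theorem LStep.mem_successors {prog : Program} {A : ActorName} {S T : Config} {α : Label}
    (h : LStep prog A S α T) : ∃ a, S.lookup A = some a ∧ T ∈ successors prog A S a := by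
  cases h with
  | letin hA hE =>
    refine ⟨_, hA, ?_⟩
    simp [successors, bump_append, hE]
  | invkSelf hA hcls hE =>
    refine ⟨_, hA, .inl ?_⟩
    simp [bump_append, hE]
  | invk hA hne hA'' hcls hE =>
    refine ⟨_, hA, .inr (Set.mem_biUnion (Finmap.mem_keys.2 (Finmap.mem_of_lookup_eq_some hA''))
      ⟨_, hA'', ?_⟩)⟩
    simp [bump_append, hE]
  | inst hA hcls hd hU => exact ⟨_, hA, _, ⟨_, hcls, hd⟩, rfl⟩
  | condEq hA hE =>
    refine ⟨_, hA, .inl ?_⟩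
    simp [bump_append, hE]
  | condNe hA hE hne =>
    refine ⟨_, hA, .inr ?_⟩
    simp [bump_append, hE]
  | plusL hA =>
    refine ⟨_, hA, .inl ?_⟩
    simp [bump_append]
  | plusR hA =>
    refine ⟨_, hA, .inr ?_⟩
    simp [bump_append]

theorem finite_absStep (prog : Program) (S : Config) : {T | AbsStep prog S T}.Finite := by
  have h : {T | AbsStep prog S T} ⊆
      ⋃ A ∈ S.keys, ⋃ a ∈ {a | S.lookup A = some a}, successors prog A S a := by
    rintro T ⟨A, α, h⟩
    obtain ⟨a, hA, hT⟩ := h.mem_successors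
    exact Set.mem_biUnion (Finmap.mem_keys.2 (Finmap.mem_of_lookup_eq_some hA))
      (Set.mem_biUnion (x := a) hA hT)
  refine (Set.Finite.biUnion (Finset.finite_toSet _) fun A _ =>
    Set.Finite.biUnion (Set.Subsingleton.finite ?_) fun a _ => finite_successors _ _ _ _).subset h
  intro b hb b' hb'
  exact Option.some.inj (Eq.trans (Eq.symm hb) hb')

/-! ### Finitely many shapes -/

/-- The processes that may follow a shape after one step. -/
def Proc.next : Proc Unit 0 → List (Proc Unit 0)
  | .nil => []
  | .letin _ P => [P.inst ()]
  | .send _ _ _ P => [P]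
  | .cond _ _ P Q => [P, Q]
  | .plus P Q => [P, Q]

/-- The expressions evaluated by the first step of a process. -/
def Proc.heads {N : Type} {n : ℕ} : Proc N n → List (Expr N n)
  | .nil => []
  | .letin E _ => [E]
  | .send _ _ Es _ => Es
  | .cond E E' _ _ => [E, E']
  | .plus _ _ => []

theorem Proc.mem_names_of_mem_heads {N : Type} {n : ℕ} {P : Proc N n} {E : Expr N n}
    (hE : E ∈ P.heads) {u : N} (hu : u ∈ E.names) : u ∈ P.names := by
  cases P with
  | nil => simp [Proc.heads] at hE
  | plus P Q => simp [Proc.heads] at hE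
  | letin E' P =>
    obtain rfl := List.mem_singleton.1 hE
    simp [Proc.names, hu]
  | send x m Es P =>
    exact List.mem_append_left _ (List.mem_append_right _ (List.mem_flatMap.2 ⟨E, hE, hu⟩))
  | cond E₁ E₂ P Q =>
    simp only [Proc.heads, List.mem_cons, List.not_mem_nil, or_false] at hE
    rcases hE with rfl | rfl <;> simp [Proc.names, hu]

theorem Proc.size_lt_of_mem_next {P Q : Proc Unit 0} (h : Q ∈ P.next) : Q.size < P.size := by
  cases P <;> simp only [Proc.next, List.mem_cons, List.not_mem_nil, or_false] at h
  · subst h; simp [Proc.size, Proc.size_inst]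
  · subst h; simp [Proc.size]
  · rcases h with rfl | rfl <;> simp only [Proc.size] <;> omega
  · rcases h with rfl | rfl <;> simp only [Proc.size] <;> omega

/-- The tree of successive continuations branches finitely and its sizes strictly decrease.
Instantiating a `let` variable stays among shapes, since every free name is the erased one. -/
theorem exists_finite_closed_of_mem (P : Proc Unit 0) : ∃ F : Set (Proc Unit 0), F.Finite ∧ P ∈ F ∧
    ∀ Q ∈ F, ∀ R ∈ Q.next, R ∈ F := by
  have ih : ∀ Q ∈ P.next, ∃ F : Set (Proc Unit 0), F.Finite ∧ Q ∈ F ∧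
      ∀ Q ∈ F, ∀ R ∈ Q.next, R ∈ F := fun Q hQ =>
    have := Proc.size_lt_of_mem_next hQ
    exists_finite_closed_of_mem Q
  choose! G hfin hmem hcl using ih
  refine ⟨insert P (⋃ Q ∈ {Q | Q ∈ P.next}, G Q),
    ((List.finite_toSet _).biUnion hfin).insert P, Set.mem_insert _ _, ?_⟩
  rintro Q (rfl | hQ) R hR
  · exact .inr (Set.mem_biUnion (x := R) hR (hmem R hR))
  · obtain ⟨Q', hQ', hQ⟩ := Set.mem_iUnion₂.1 hQ
    exact .inr (Set.mem_biUnion hQ' (hcl Q' hQ' Q hQ R hR))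
termination_by P.size

theorem exists_finite_closed {X : Set (Proc Unit 0)} (hX : X.Finite) :
    ∃ F : Set (Proc Unit 0), F.Finite ∧ X ⊆ F ∧ ∀ Q ∈ F, ∀ R ∈ Q.next, R ∈ F := by
  choose G hfin hmem hcl using exists_finite_closed_of_mem
  refine ⟨⋃ Q ∈ X, G Q, hX.biUnion fun Q _ => hfin Q,
    fun Q hQ => Set.mem_biUnion hQ (hmem Q), fun Q hQ R hR => ?_⟩
  obtain ⟨Q', hQ', hQ⟩ := Set.mem_iUnion₂.1 hQ
  exact Set.mem_biUnion hQ' (hcl Q' Q hQ R hR)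

/-- Finite sets of shapes, of method names with numbers of arguments, and of classes that contain
all those that occur in an execution of the program. -/
structure Bounds (prog : Program) where
  shapes : Set (Proc Unit 0)
  meths : Set (MethName × ℕ)
  classes : Set (Option ClassName)
  finite_shapes : shapes.Finite
  finite_meths : meths.Finite
  finite_classes : classes.Finite
  nil_mem : .nil ∈ shapes
  main_mem : prog.main.shape ∈ shapes
  body_mem : ∀ C m d, prog.defs C m = some d → d.body.shape ∈ shapes
  closed : ∀ P ∈ shapes, ∀ Q ∈ P.next, Q ∈ shapes
  send_mem : ∀ x m Es P, Proc.send x m Es P ∈ shapes → (m, Es.length) ∈ meths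
  none_mem : none ∈ classes
  new_mem : ∀ P ∈ shapes, ∀ C, .new C ∈ P.heads → some C ∈ classes

theorem nonempty_bounds (prog : Program) : Nonempty (Bounds prog) := by
  have hB : {P | ∃ C m d, prog.defs C m = some d ∧ P = d.body.shape}.Finite := by
    refine (prog.finite_defs.image fun p =>
      ((prog.defs p.1 p.2).map fun d => d.body.shape).getD .nil).subset ?_
    rintro P ⟨C, m, d, hd, rfl⟩
    exact ⟨(C, m), by simp [hd], by simp [hd]⟩
  obtain ⟨F, hF, hX, hcl⟩ := exists_finite_closed ((hB.insert prog.main.shape).insert .nil)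
  -- The fallback values `(0, 0)` and `none` only enlarge the finite sets, which is harmless.
  refine ⟨⟨F, (fun P => match P with
      | .send _ m Es _ => (m, Es.length)
      | _ => (0, 0)) '' F,
    insert none (⋃ P ∈ F, (fun E : Expr Unit 0 => match E with
      | .new C => some C
      | _ => none) '' {E | E ∈ P.heads}), hF, hF.image _,
    (hF.biUnion fun P _ => (List.finite_toSet _).image _).insert none, hX (.inl rfl),
    hX (.inr (.inl rfl)), fun C m d hd => hX (.inr (.inr ⟨C, m, d, hd, rfl⟩)), hcl,
    fun x m Es P h => ⟨_, h, rfl⟩, .inl rfl,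
    fun P hP C hC => .inr (Set.mem_biUnion hP ⟨_, hC, rfl⟩)⟩⟩

section Bounds

variable {prog : Program} (b : Bounds prog)

/-- If the value is an actor name, then its class is within the bounds. -/
def Bounds.GoodValue (u : Value) : Prop :=
  ∀ A, u = .actor A → A.cls ∈ b.classes

/-- The components of the message are within the bounds. -/
def Bounds.GoodMsg (μ : Msg) : Prop :=
  (μ.meth, μ.args.length) ∈ b.meths ∧ ∀ u ∈ Value.actor μ.target :: μ.args, b.GoodValue u

/-- The components of the actor are within the bounds. -/
def Bounds.GoodState (A : ActorName) (a : ActorState) : Prop :=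
  A.cls ∈ b.classes ∧ a.proc.shape ∈ b.shapes ∧ (∀ u ∈ a.proc.names, b.GoodValue u) ∧
    ∀ μ ∈ a.queue, b.GoodMsg μ

/-- The components of the configuration are within the bounds. -/
def Bounds.Good (S : Config) : Prop :=
  ∀ A a, S.lookup A = some a → b.GoodState A a

variable {b} {S T : Config}

theorem Bounds.Good.insert (h : b.Good S) {A : ActorName} {a : ActorState}
    (ha : b.GoodState A a) : b.Good (S.insert A a) := by
  intro B c hB
  rw [lookup_insert_eq] at hB
  split_ifs at hB with hBA
  · cases hB; subst hBA; exact ha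
  · exact h B c hB

theorem Bounds.Good.evalOne (h : b.Good S) {E : Expr Value 0}
    (hE : ∀ u ∈ E.names, b.GoodValue u) (hnew : ∀ C, E = .new C → some C ∈ b.classes) :
    b.Good (evalOne S E).2 ∧ b.GoodValue (evalOne S E).1 := by
  rcases E with (u | i) | C
  · exact ⟨h, hE u (List.mem_singleton.2 rfl)⟩
  · exact i.elim0
  · have := hnew C rfl
    refine ⟨h.insert ⟨this, b.nil_mem, by simp [Proc.names], by simp⟩, fun A hA => ?_⟩
    cases hA
    exact this

theorem Bounds.Good.evalList : (Es : List (Expr Value 0)) → {S : Config} → b.Good S →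
    (∀ E ∈ Es, ∀ u ∈ E.names, b.GoodValue u) → (∀ C, .new C ∈ Es → some C ∈ b.classes) →
    b.Good (evalList S Es).2 ∧ ∀ u ∈ (evalList S Es).1, b.GoodValue u
  | [], _, h, _, _ => ⟨h, by simp [StatelessActor.evalList]⟩
  | E :: Es, S, h, hE, hnew => by
    have h₁ := h.evalOne (hE E List.mem_cons_self) fun C hC => hnew C (hC ▸ List.mem_cons_self)
    have h₂ := Bounds.Good.evalList Es h₁.1 (fun E' hE' => hE E' (List.mem_cons_of_mem _ hE'))
      fun C hC => hnew C (List.mem_cons_of_mem _ hC)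
    refine ⟨h₂.1, fun u hu => ?_⟩
    rcases List.mem_cons.1 hu with rfl | hu
    · exact h₁.2
    · exact h₂.2 u hu

/-- Erasing names keeps the constants `new C`, so the classes of created actors can be read off the
shape. -/
theorem Bounds.Good.eval_heads (h : b.Good S) {A : ActorName} {a : ActorState}
    (hA : S.lookup A = some a) :
    b.Good (StatelessActor.evalList S a.proc.heads).2 ∧
      ∀ u ∈ (StatelessActor.evalList S a.proc.heads).1, b.GoodValue u := by
  have ha := h A a hA
  refine h.evalList _ (fun E hE u hu => ha.2.2.1 u (Proc.mem_names_of_mem_heads hE hu)) fun C hC => ?_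
  refine b.new_mem _ ha.2.1 C ?_
  have : a.proc.shape.heads = a.proc.heads.map (Expr.map fun _ => ()) := by
    cases a.proc <;> rfl
  rw [this]
  exact List.mem_map.2 ⟨_, hC, rfl⟩

theorem mem_of_lookup_eq_some {α β : Type*} [BEq α] [LawfulBEq α] {x : α} {y : β} :
    {l : List (α × β)} → l.lookup x = some y → (x, y) ∈ l
  | [], h => by simp at h
  | (x', y') :: l, h => by
    rw [List.lookup_cons] at h
    split at h
    · next hx =>
      obtain rfl := eq_of_beq hx
      cases h
      exact List.mem_cons_self
    · exact List.mem_cons_of_mem _ (mem_of_lookup_eq_some h)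

/-- A continuation has a shape in `next`, an instance has the shape of a method body, and a sent
message has the arity of its `send` prefix. Every new name is a value already present, a created
actor, or a fresh variable, to which the class bound does not apply. -/
theorem Bounds.Good.step (h : b.Good S) {A : ActorName} {α : Label}
    (hst : LStep prog A S α T) : b.Good T := by
  cases hst with
  | @letin σ n E P q U T hA hE =>
    have ha := h _ _ hA
    have hT := h.eval_heads hA
    simp only [Proc.heads, evalList_singleton, hE, List.mem_singleton, forall_eq] at hT
    refine hT.1.insert ⟨ha.1, b.closed _ ha.2.1 _ ?_, fun v hv => ?_, ha.2.2.2⟩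
    · simp [Proc.shape, Proc.map, Proc.next, Proc.map_inst]
    · rcases Proc.mem_names_inst hv with rfl | hv
      · exact hT.2
      · exact ha.2.2.1 v (by simp [Proc.names, hv])
  | @invkSelf σ n A' m Es P q U T hA hcls hE =>
    have ha := h _ _ hA
    have hT := h.eval_heads hA
    simp only [Proc.heads, hE] at hT
    refine hT.1.insert ⟨ha.1, b.closed _ ha.2.1 _ ?_, fun v hv => ?_, fun μ hμ => ?_⟩
    · simp [Proc.shape, Proc.map, Proc.next]
    · exact ha.2.2.1 v (by simp [Proc.names, hv])
    · rcases List.mem_append.1 hμ with hμ | hμ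
      · exact ha.2.2.2 μ hμ
      · rw [List.mem_singleton.1 hμ]
        refine ⟨?_, fun u hu => ?_⟩
        · have := b.send_mem _ _ _ _ ha.2.1
          rw [List.length_map, ← length_evalList Es S, hE] at this
          exact this
        · rcases List.mem_cons.1 hu with rfl | hu
          · exact ha.2.2.1 _ (by simp [Proc.names, Name.names])
          · exact hT.2 u hu
  | @invk σ σ' n A' A'' m Es P P' q q' U T hA hne hA'' hcls hE =>
    have ha := h _ _ hA
    have hT := h.eval_heads hA
    simp only [Proc.heads, hE] at hT
    have ha'' := h _ _ hA''
    have h₁ : b.GoodState A ⟨σ ++ [n + 1], P, q⟩ := by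
      refine ⟨ha.1, b.closed _ ha.2.1 _ ?_, fun v hv => ?_, ha.2.2.2⟩
      · simp [Proc.shape, Proc.map, Proc.next]
      · exact ha.2.2.1 v (by simp [Proc.names, hv])
    refine (hT.1.insert h₁).insert ⟨ha''.1, ha''.2.1, ha''.2.2.1, fun μ hμ => ?_⟩
    · rcases List.mem_append.1 hμ with hμ | hμ
      · exact ha''.2.2.2 μ hμ
      · rw [List.mem_singleton.1 hμ]
        refine ⟨?_, fun u hu => ?_⟩
        · have := b.send_mem _ _ _ _ ha.2.1
          rw [List.length_map, ← length_evalList Es S, hE] at this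
          exact this
        · rcases List.mem_cons.1 hu with rfl | hu
          · exact ha.2.2.1 _ (by simp [Proc.names, Name.names])
          · exact hT.2 u hu
  | @inst σ σ' C m d U A' q hA hcls hd hU =>
    have ha := h _ _ hA
    have hμ := ha.2.2.2 _ List.mem_cons_self
    refine h.insert ⟨ha.1, ?_, fun v hv => ?_, fun μ hμ => ha.2.2.2 μ (List.mem_cons_of_mem _ hμ)⟩
    · simp only [MethodDef.instantiate, Proc.shape_map]
      exact b.body_mem C m d hd
    · simp only [MethodDef.instantiate, Proc.names_map, List.mem_map] at hv
      obtain ⟨x, -, rfl⟩ := hv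
      split_ifs
      · exact hμ.2 _ List.mem_cons_self
      · split
        · next u hu =>
          exact hμ.2 u (List.mem_cons_of_mem _ (List.of_mem_zip (mem_of_lookup_eq_some hu)).2)
        · intro A hA; cases hA
  | @condEq σ n E E' P Q q U T hA hE =>
    have ha := h _ _ hA
    have hT := h.eval_heads hA
    simp only [Proc.heads, hE] at hT
    refine hT.1.insert ⟨ha.1, b.closed _ ha.2.1 _ ?_, fun v hv => ?_, ha.2.2.2⟩
    · simp [Proc.shape, Proc.map, Proc.next]
    · exact ha.2.2.1 v (by simp [Proc.names, hv])
  | @condNe σ n E E' P Q q U V T hA hE =>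
    have ha := h _ _ hA
    have hT := h.eval_heads hA
    simp only [Proc.heads, hE] at hT
    refine hT.1.insert ⟨ha.1, b.closed _ ha.2.1 _ ?_, fun v hv => ?_, ha.2.2.2⟩
    · simp [Proc.shape, Proc.map, Proc.next]
    · exact ha.2.2.1 v (by simp [Proc.names, hv])
  | @plusL σ n P Q q hA =>
    have ha := h _ _ hA
    refine h.insert ⟨ha.1, b.closed _ ha.2.1 _ ?_, fun v hv => ?_, ha.2.2.2⟩
    · simp [Proc.shape, Proc.map, Proc.next]
    · exact ha.2.2.1 v (by simp [Proc.names, hv])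
  | @plusR σ n P Q q hA =>
    have ha := h _ _ hA
    refine h.insert ⟨ha.1, b.closed _ ha.2.1 _ ?_, fun v hv => ?_, ha.2.2.2⟩
    · simp [Proc.shape, Proc.map, Proc.next]
    · exact ha.2.2.1 v (by simp [Proc.names, hv])

theorem Bounds.good_of_reachable (b : Bounds prog) (h : prog.Reachable S) : b.Good S := by
  induction h with
  | refl =>
    intro A a hA
    by_cases hr : A = root
    · subst hr
      obtain rfl : _ = a := Option.some.inj (Finmap.lookup_singleton_eq.symm.trans hA)
      refine ⟨b.none_mem, ?_, fun u hu => ?_, by simp⟩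
      · simp only [Proc.shape_map]; exact b.main_mem
      · simp only [Proc.names_map, List.mem_map] at hu
        obtain ⟨x, -, rfl⟩ := hu
        intro B hB
        cases hB
    · have := (Finmap.mem_singleton _ _ _).1 (Finmap.mem_of_lookup_eq_some hA)
      exact (hr this).elim
  | tail _ h ih =>
    obtain ⟨A, α, h⟩ := h
    exact ih.step h

end Bounds

/-! ### Well-quasi-ordering -/

theorem finite_lists {α : Type*} {X : Set α} (hX : X.Finite) :
    (k : ℕ) → {l : List α | l.length = k ∧ ∀ x ∈ l, x ∈ X}.Finite
  | 0 => (Set.finite_singleton []).subset fun l hl => List.length_eq_zero_iff.1 hl.1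
  | k + 1 => by
    refine (hX.image2 List.cons (finite_lists hX k)).subset ?_
    rintro (_ | ⟨x, l⟩) ⟨hl, h⟩
    · cases hl
    · exact ⟨x, h x List.mem_cons_self, l, ⟨by simpa using hl, fun y hy =>
        h y (List.mem_cons_of_mem _ hy)⟩, rfl⟩

theorem partiallyWellOrderedOn_of_finite_image {α β : Type*} {s : Set α} {c : α → β}
    (h : (c '' s).Finite) : s.PartiallyWellOrderedOn fun x y => c x = c y := by
  rw [Set.partiallyWellOrderedOn_iff_exists_lt]
  intro f hf
  exact (h.partiallyWellOrderedOn (r := Eq)).exists_lt fun n => ⟨f n, hf n, rfl⟩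

section WQO

variable {prog : Program} (b : Bounds prog)

/-- Classes are bounded, the main process has finitely many free variables, and positions are below
`k`. -/
theorem finite_codes (k : ℕ) :
    (prog.code '' {L | L.length = k ∧ ∀ u ∈ L, b.GoodValue u}).Finite := by
  have h₁ : (insert none (some '' b.classes)).Finite := (b.finite_classes.image _).insert _
  have h₂ : (insert none (some '' {x | x ∈ prog.main.names})).Finite :=
    ((List.finite_toSet _).image _).insert _
  refine (finite_lists ((h₁.prod h₂).prod (Set.finite_Iio k)) k).subset ?_
  rintro _ ⟨L, ⟨hk, hL⟩, rfl⟩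
  refine ⟨by simpa [Program.code] using hk, fun p hp => ?_⟩
  obtain ⟨u, hu, rfl⟩ := List.mem_map.1 hp
  refine ⟨⟨?_, ?_⟩, hk ▸ List.idxOf_lt_length_of_mem hu⟩
  · cases u with
    | var x => exact .inl rfl
    | actor A => exact .inr ⟨_, hL _ hu A rfl, rfl⟩
  · cases u with
    | var x =>
      by_cases hx : x ∈ prog.main.names
      · exact .inr ⟨x, hx, by simp [Program.kind, hx]⟩
      · exact .inl (by simp [Program.kind, hx])
    | actor A => exact .inl rfl

theorem finite_msgCodes : (prog.msgCode '' {μ | b.GoodMsg μ}).Finite := by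
  -- The extra entry in the coded list is the addressee.
  refine (b.finite_meths.biUnion fun p _ => (Set.finite_singleton p.1).prod
    (finite_codes b (p.2 + 1))).subset ?_
  rintro _ ⟨μ, hμ, rfl⟩
  exact Set.mem_biUnion hμ.1 ⟨rfl, _, ⟨by simp, hμ.2⟩, rfl⟩

theorem finite_procCodes :
    (prog.procCode '' {P | P.shape ∈ b.shapes ∧ ∀ u ∈ P.names, b.GoodValue u}).Finite := by
  refine (b.finite_shapes.biUnion fun s _ => (Set.finite_singleton s).prod
    (finite_codes b s.names.length)).subset ?_
  rintro _ ⟨P, hP, rfl⟩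
  refine Set.mem_biUnion hP.1 ⟨rfl, _, ⟨?_, hP.2⟩, rfl⟩
  simp [Proc.shape, Proc.names_map]

/-- The ordering on the terms of configurations. -/
def Program.TermLE (prog : Program) (p p' : ActorName × ActorState) : Prop :=
  (p.1.cls, prog.procCode p.2.proc) = (p'.1.cls, prog.procCode p'.2.proc) ∧
    QueueLE prog p.2.queue p'.2.queue

theorem isPreorder_msg (prog : Program) :
    IsPreorder Msg fun μ μ' => prog.msgCode μ = prog.msgCode μ' where
  refl _ := rfl
  trans _ _ _ h h' := h.trans h'

theorem queueLE_refl (q : List Msg) : QueueLE prog q q := by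
  have := isPreorder_msg prog
  rw [queueLE_iff]
  exact refl q

theorem queueLE_trans {q q' q'' : List Msg} (h : QueueLE prog q q') (h' : QueueLE prog q' q'') :
    QueueLE prog q q'' := by
  have := isPreorder_msg prog
  rw [queueLE_iff] at *
  exact _root_.trans h h'

theorem isPreorder_termLE (prog : Program) : IsPreorder _ prog.TermLE where
  refl _ := ⟨rfl, queueLE_refl _⟩
  trans _ _ _ h h' := ⟨h.1.trans h'.1, queueLE_trans h.2 h'.2⟩

/-- Higman's lemma over the finite alphabet of message codes. -/
theorem partiallyWellOrderedOn_queueLE :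
    {q | ∀ μ ∈ q, b.GoodMsg μ}.PartiallyWellOrderedOn (QueueLE prog) := by
  have := isPreorder_msg prog
  have h := Set.PartiallyWellOrderedOn.partiallyWellOrderedOn_sublistForall₂ _
    (partiallyWellOrderedOn_of_finite_image (finite_msgCodes b))
  rwa [show QueueLE prog = _ from funext₂ fun _ _ => propext queueLE_iff]

/-- A product of two orders: the finitely many pairs of class and process code, and the embedding of
queues. -/
theorem partiallyWellOrderedOn_termLE :
    {p | b.GoodState p.1 p.2}.PartiallyWellOrderedOn prog.TermLE := by
  have h : {p | b.GoodState p.1 p.2}.PartiallyWellOrderedOn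
      fun p p' : ActorName × ActorState => (p.1.cls, prog.procCode p.2.proc) = (p'.1.cls, prog.procCode p'.2.proc) := by
    refine partiallyWellOrderedOn_of_finite_image
      (((b.finite_classes.prod (finite_procCodes b)).subset ?_))
    rintro _ ⟨p, hp, rfl⟩
    exact ⟨hp.1, p.2.proc, ⟨hp.2.1, hp.2.2.1⟩, rfl⟩
  rw [Set.partiallyWellOrderedOn_iff_exists_lt]
  intro f hf
  exact (h.prod (partiallyWellOrderedOn_queueLE b)).exists_lt
    (f := fun n => (f n, (f n).2.queue)) fun n => ⟨hf n, (hf n).2.2.2⟩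

/-- Puts a configuration in the form of a list, so that Higman's lemma applies; the order of the
terms is arbitrary. -/
theorem exists_terms (S : Config) : ∃ l : List (ActorName × ActorState),
    (∀ p, p ∈ l ↔ S.lookup p.1 = some p.2) ∧ l.Pairwise fun p p' => p.1 ≠ p'.1 := by
  refine ⟨S.keys.toList.filterMap fun A => (S.lookup A).map (A, ·), fun p => ?_, ?_⟩
  · simp only [List.mem_filterMap, Finset.mem_toList, Option.map_eq_some_iff]
    constructor
    · rintro ⟨A, -, a, hA, rfl⟩
      exact hA
    · intro h
      exact ⟨p.1, Finmap.mem_keys.2 (Finmap.mem_of_lookup_eq_some h), p.2, h, rfl⟩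
  · refine List.Pairwise.filterMap _ (fun A A' h p hp p' hp' => ?_) (Finset.nodup_toList S.keys)
    obtain ⟨a, -, rfl⟩ := Option.map_eq_some_iff.1 hp
    obtain ⟨a', -, rfl⟩ := Option.map_eq_some_iff.1 hp'
    exact h

/-- Different entries are matched with entries at different positions, and keys are not repeated in
`l'`, so the induced map on keys is injective. -/
theorem exists_injOn_of_sublistForall₂ {α β : Type*} [DecidableEq α] {r : α × β → α × β → Prop}
    {l l' : List (α × β)} (h : List.SublistForall₂ r l l')
    (hl : l.Pairwise fun p p' => p.1 ≠ p'.1) (hl' : l'.Pairwise fun p p' => p.1 ≠ p'.1) :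
    ∃ f : α → α, Set.InjOn f {A | ∃ p ∈ l, p.1 = A} ∧
      ∀ p ∈ l, ∃ p' ∈ l', p'.1 = f p.1 ∧ r p p' := by
  induction h with
  | nil => exact ⟨id, Set.injOn_id _, by simp⟩
  | @cons a a' l l' har _ ih =>
    rw [List.pairwise_cons] at hl hl'
    obtain ⟨f, hf, h⟩ := ih hl.2 hl'.2
    have hfp : ∀ p ∈ l, Function.update f a.1 a'.1 p.1 = f p.1 := fun p hp =>
      Function.update_of_ne (hl.1 p hp).symm _ _
    have hne : ∀ p ∈ l, f p.1 ≠ a'.1 := fun p hp he => by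
      obtain ⟨p', hp', h', -⟩ := h p hp
      exact hl'.1 p' hp' (h'.trans he).symm
    refine ⟨Function.update f a.1 a'.1, ?_, fun p hp => ?_⟩
    · rintro _ ⟨p, hp, rfl⟩ _ ⟨p', hp', rfl⟩ he
      rcases List.mem_cons.1 hp with hpa | hp <;> rcases List.mem_cons.1 hp' with hpa' | hp'
      · rw [hpa, hpa']
      · rw [hpa, Function.update_self, hfp p' hp'] at he
        exact (hne p' hp' he.symm).elim
      · rw [hpa', Function.update_self, hfp p hp] at he
        exact (hne p hp he).elim
      · rw [hfp p hp, hfp p' hp'] at he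
        exact hf ⟨p, hp, rfl⟩ ⟨p', hp', rfl⟩ he
    · rcases List.mem_cons.1 hp with rfl | hp
      · exact ⟨a', List.mem_cons_self, (Function.update_self (f := f) ..).symm, har⟩
      · obtain ⟨p', hp', h', hr⟩ := h p hp
        exact ⟨p', List.mem_cons_of_mem _ hp', h'.trans (hfp p hp).symm, hr⟩
  | cons_right _ ih =>
    obtain ⟨f, hf, h⟩ := ih hl (List.pairwise_cons.1 hl').2
    refine ⟨f, hf, fun p hp => ?_⟩
    obtain ⟨p', hp', h⟩ := h p hp
    exact ⟨p', List.mem_cons_of_mem _ hp', h⟩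

/-- The injection `f` embeds the terms of `S` into those of `S'`. -/
def Program.LEVia (prog : Program) (f : ActorName → ActorName) (S S' : Config) : Prop :=
  Set.InjOn f {A | A ∈ S} ∧
    ∀ A a, S.lookup A = some a → ∃ a', S'.lookup (f A) = some a' ∧ prog.TermLE (A, a) (f A, a')

theorem configLE_iff {S S' : Config} : ConfigLE prog S S' ↔ ∃ f, prog.LEVia f S S' := by
  refine exists_congr fun f => and_congr_right fun _ =>
    forall₃_congr fun A a _ => ⟨?_, ?_⟩
  · rintro ⟨h, a', ha', hp, hq⟩
    exact ⟨a', ha', Prod.ext h.symm (procEquiv_iff.1 hp), hq⟩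
  · rintro ⟨a', ha', h, hq⟩
    obtain ⟨h, hp⟩ := Prod.ext_iff.1 h
    exact ⟨h.symm, a', ha', procEquiv_iff.2 hp, hq⟩

theorem configLE_refl (S : Config) : ConfigLE prog S S :=
  configLE_iff.2 ⟨id, Set.injOn_id _, fun _ a ha => ⟨a, ha, rfl, queueLE_refl _⟩⟩

theorem configLE_trans {S S' S'' : Config} (h : ConfigLE prog S S') (h' : ConfigLE prog S' S'') :
    ConfigLE prog S S'' := by
  rw [configLE_iff] at *
  obtain ⟨f, hf, h⟩ := h
  obtain ⟨f', hf', h'⟩ := h'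
  refine ⟨f' ∘ f, hf'.comp hf fun A hA => ?_, fun A a hA => ?_⟩
  · obtain ⟨a, ha⟩ := Finmap.mem_iff.1 hA
    obtain ⟨a', ha', -⟩ := h A a ha
    exact Finmap.mem_of_lookup_eq_some ha'
  · obtain ⟨a', ha', hle⟩ := h A a hA
    obtain ⟨a'', ha'', hle'⟩ := h' _ a' ha'
    exact ⟨a'', ha'', (isPreorder_termLE prog).trans _ _ _ hle hle'⟩

theorem wellQuasiOrdered_configLE (prog : Program) :
    WellQuasiOrdered fun S S' : {S : Config // prog.Reachable S} => ConfigLE prog S.1 S'.1 := by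
  obtain ⟨b⟩ := nonempty_bounds prog
  have := isPreorder_termLE prog
  have h := Set.PartiallyWellOrderedOn.partiallyWellOrderedOn_sublistForall₂ _
    (partiallyWellOrderedOn_termLE b)
  intro S
  choose l hl hp using fun n => exists_terms (S n).1
  obtain ⟨m, n, hmn, hle⟩ := h.exists_lt (f := l) fun n p hp =>
    b.good_of_reachable (S n).2 p.1 p.2 ((hl n p).1 hp)
  refine ⟨m, n, hmn, configLE_iff.2 ?_⟩
  obtain ⟨f, hf, hle⟩ := exists_injOn_of_sublistForall₂ hle (hp m) (hp n)
  refine ⟨f, hf.mono fun A hA => ?_, fun A a hA => ?_⟩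
  · obtain ⟨a, ha⟩ := Finmap.mem_iff.1 hA
    exact ⟨(A, a), (hl m _).2 ha, rfl⟩
  · obtain ⟨⟨A', a'⟩, hp', h', hr⟩ := hle (A, a) ((hl m _).2 hA)
    obtain rfl : A' = f A := h'
    exact ⟨a', (hl n _).1 hp', hr⟩

end WQO

/-! ### Embeddings of queues -/

section Queue

variable {prog : Program}

theorem queueLE_append {q q' r r' : List Msg} (h : QueueLE prog q q') (hr : QueueLE prog r r') :
    QueueLE prog (q ++ r) (q' ++ r') := by
  obtain ⟨l, hl, hs⟩ := List.sublistForall₂_iff.1 h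
  obtain ⟨l', hl', hs'⟩ := List.sublistForall₂_iff.1 hr
  exact List.sublistForall₂_iff.2 ⟨l ++ l', List.rel_append hl hl', hs.append hs'⟩

theorem queueLE_append_right {q q' : List Msg} (h : QueueLE prog q q') (r : List Msg) :
    QueueLE prog q (q' ++ r) := by
  simpa using queueLE_append h (List.SublistForall₂.nil (l := r))

theorem queueLE_concat {q q' : List Msg} {μ μ' : Msg} (h : QueueLE prog q q')
    (hμ : prog.msgCode μ = prog.msgCode μ') : QueueLE prog (q ++ [μ]) (q' ++ [μ']) :=
  queueLE_append h (.cons (msgEquiv_iff.2 hμ) .nil)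

/-- The prefix `p` is what the larger actor has to consume before it reaches the message matching
`μ`. -/
theorem exists_of_queueLE_cons {μ : Msg} {q q' : List Msg} (h : QueueLE prog (μ :: q) q') :
    ∃ p μ' r, q' = p ++ μ' :: r ∧ prog.msgCode μ = prog.msgCode μ' ∧ QueueLE prog q r := by
  induction q' with
  | nil => cases h
  | cons ν q' ih =>
    cases h with
    | cons h hq => exact ⟨[], ν, q', rfl, msgEquiv_iff.1 h, hq⟩
    | cons_right hq =>
      obtain ⟨p, μ', r, rfl, hμ⟩ := ih hq
      exact ⟨ν :: p, μ', r, rfl, hμ⟩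

end Queue

/-! ### Embeddings of configurations -/

section LEVia

variable {prog : Program} {f : ActorName → ActorName} {S S' : Config}

theorem Program.LEVia.insert (h : prog.LEVia f S S') {A : ActorName} (hA : A ∈ S)
    {a a' : ActorState} (hp : prog.procCode a.proc = prog.procCode a'.proc)
    (hq : QueueLE prog a.queue a'.queue) :
    prog.LEVia f (S.insert A a) (S'.insert (f A) a') := by
  have hmem : ∀ B, B ∈ S.insert A a → B ∈ S := fun B hB => by
    rcases Finmap.mem_insert.1 hB with rfl | hB
    · exact hA
    · exact hB
  refine ⟨h.1.mono hmem, fun B b hB => ?_⟩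
  rw [lookup_insert_eq] at hB
  split_ifs at hB with hBA
  · cases hB
    subst hBA
    obtain ⟨a₀, ha₀⟩ := Finmap.mem_iff.1 hA
    obtain ⟨_, -, hle, -⟩ := h.2 B a₀ ha₀
    exact ⟨a', Finmap.lookup_insert _, Prod.ext (Prod.ext_iff.1 hle).1 hp, hq⟩
  · rw [lookup_insert_eq, if_neg fun he =>
      hBA (h.1 (Finmap.mem_of_lookup_eq_some hB) hA he)]
    exact h.2 B b hB

theorem Program.LEVia.insert_new (h : prog.LEVia f S S') {A A' : ActorName} (hA : A ∉ S)
    (hA' : A' ∉ S') {a a' : ActorState} (hle : prog.TermLE (A, a) (A', a')) :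
    prog.LEVia (Function.update f A A') (S.insert A a) (S'.insert A' a') := by
  have hne : ∀ B ∈ S, B ≠ A := fun B hB he => hA (he ▸ hB)
  have hne' : ∀ B ∈ S, f B ≠ A' := fun B hB he => by
    obtain ⟨b, hb⟩ := Finmap.mem_iff.1 hB
    obtain ⟨b', hb', -⟩ := h.2 B b hb
    exact hA' (he ▸ Finmap.mem_of_lookup_eq_some hb')
  refine ⟨fun B hB B' hB' he => ?_, fun B b hB => ?_⟩
  · rcases Finmap.mem_insert.1 hB with hB | hB <;> rcases Finmap.mem_insert.1 hB' with hB' | hB'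
    · rw [hB, hB']
    · rw [hB, Function.update_self, Function.update_of_ne (hne _ hB')] at he
      exact (hne' _ hB' he.symm).elim
    · rw [hB', Function.update_self, Function.update_of_ne (hne _ hB)] at he
      exact (hne' _ hB he).elim
    · rw [Function.update_of_ne (hne _ hB), Function.update_of_ne (hne _ hB')] at he
      exact h.1 hB hB' he
  · rw [lookup_insert_eq] at hB
    split_ifs at hB with hBA
    · cases hB
      subst hBA
      rw [Function.update_self]
      exact ⟨a', Finmap.lookup_insert _, hle⟩
    · have hBS := Finmap.mem_of_lookup_eq_some hB
      rw [Function.update_of_ne hBA, lookup_insert_eq, if_neg (hne' B hBS)]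
      exact h.2 B b hB

/-- The injection `f` embeds the actors of `S` into those of `S'`, and `θ` is an admissible
renaming of the values in `X` that occur in `S` to values that occur in `S'`. -/
structure Sim (prog : Program) (f : ActorName → ActorName) (θ : Value → Value) (X : Set Value)
    (S S' : Config) : Prop where
  le : prog.LEVia f S S'
  iso : prog.IsoOn X θ
  occurs : ∀ u ∈ X, Occurs u S
  occurs' : ∀ u ∈ X, Occurs (θ u) S'

variable {θ : Value → Value} {X : Set Value}

/-- When an actor is created, both `f` and `θ` are extended to send the fresh name on the left to
the fresh name on the right. The occurrence conditions in `Sim` guarantee that these names are new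
to `X` and to its image. -/
theorem Sim.evalOne (h : Sim prog f θ X S S') {E : Expr Value 0} (hE : ∀ u ∈ E.names, u ∈ X) :
    ∃ f' θ', Set.EqOn f' f {A | A ∈ S} ∧ Set.EqOn θ' θ X ∧
      Sim prog f' θ' (insert (evalOne S E).1 X) (evalOne S E).2 (evalOne S' (E.map θ)).2 ∧
      (StatelessActor.evalOne S' (E.map θ)).1 = θ' (StatelessActor.evalOne S E).1 := by
  rcases E with (u | i) | C
  · have hu : u ∈ X := hE u (List.mem_singleton.2 rfl)
    refine ⟨f, θ, fun _ _ => rfl, fun _ _ => rfl, ?_, rfl⟩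
    simp only [StatelessActor.evalOne, Expr.map, Name.map, Set.insert_eq_of_mem hu]
    exact h
  · exact i.elim0
  · set A := freshActor S C with hA
    set A' := freshActor S' C with hA'
    obtain ⟨θ', hθ, hθA, hiso⟩ := h.iso.extend (ι := Unit) (g := fun _ => .actor A)
      (g' := fun _ => .actor A') (fun _ _ _ => rfl) (fun _ _ _ => rfl)
      (fun _ hX => not_occurs_freshActor S C (h.occurs _ hX))
      (by
        rintro _ ⟨u, hu, he⟩
        exact not_occurs_freshActor S' C (he ▸ h.occurs' u hu))
      (fun _ => rfl)
    have hle := h.le.insert_new (freshActor_notMem S C) (freshActor_notMem S' C)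
      (a := ⟨[], .nil, []⟩) (a' := ⟨[], .nil, []⟩) ⟨rfl, queueLE_refl _⟩
    refine ⟨_, θ', fun B hB => Function.update_of_ne (fun he => freshActor_notMem S C ?_) _ _,
      hθ, ⟨hle, hiso.mono ?_, ?_, ?_⟩, (hθA ()).symm⟩
    · exact he ▸ hB
    · rintro u (rfl | hu)
      · exact .inr ⟨(), rfl⟩
      · exact .inl hu
    · rintro u (rfl | hu)
      · exact occurs_of_lookup (Finmap.lookup_insert S)
      · exact (evalOne_addsIdle S (.new C)).occurs (h.occurs u hu)
    · rintro u (rfl | hu)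
      · exact (hθA ()).symm ▸ occurs_of_lookup (Finmap.lookup_insert S')
      · rw [hθ hu]
        exact (evalOne_addsIdle S' (.new C)).occurs (h.occurs' u hu)

theorem Sim.evalList : (Es : List (Expr Value 0)) → {f : ActorName → ActorName} →
    {θ : Value → Value} → {X : Set Value} → {S S' : Config} → Sim prog f θ X S S' →
    (∀ E ∈ Es, ∀ u ∈ E.names, u ∈ X) →
    ∃ f' θ', Set.EqOn f' f {A | A ∈ S} ∧ Set.EqOn θ' θ X ∧
      Sim prog f' θ' (X ∪ {u | u ∈ (evalList S Es).1}) (evalList S Es).2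
        (evalList S' (Es.map (Expr.map θ))).2 ∧
      (StatelessActor.evalList S' (Es.map (Expr.map θ))).1 =
        (StatelessActor.evalList S Es).1.map θ'
  | [], f, θ, X, S, S', h, _ => by
    refine ⟨f, θ, fun _ _ => rfl, fun _ _ => rfl, ?_, rfl⟩
    have : X ∪ {u | u ∈ (StatelessActor.evalList S []).1} = X := by
      simp [StatelessActor.evalList]
    rw [this]
    exact h
  | E :: Es, f, θ, X, S, S', h, hE => by
    obtain ⟨f₁, θ₁, hf₁, hθ₁, h₁, hU₁⟩ := h.evalOne (hE E List.mem_cons_self)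
    -- The remaining expressions mention only names in `X`, where the extension agrees with `θ`.
    have hEs : Es.map (Expr.map θ) = Es.map (Expr.map θ₁) :=
      List.map_congr_left fun E' hE' => Expr.map_congr E' fun u hu =>
        (hθ₁ (hE E' (List.mem_cons_of_mem _ hE') u hu)).symm
    obtain ⟨f₂, θ₂, hf₂, hθ₂, h₂, hU₂⟩ := Sim.evalList Es h₁ fun E' hE' u hu =>
      .inr (hE E' (List.mem_cons_of_mem _ hE') u hu)
    refine ⟨f₂, θ₂, fun A hA => ?_, fun u hu => (hθ₂ (.inr hu)).trans (hθ₁ hu), ?_, ?_⟩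
    · obtain ⟨a, ha⟩ := Finmap.mem_iff.1 hA
      exact (hf₂ (Finmap.mem_of_lookup_eq_some ((evalOne_addsIdle S E).lookup_eq ha))).trans
        (hf₁ hA)
    · simp only [List.map_cons, hEs, StatelessActor.evalList]
      convert h₂ using 1
      ext u
      simp only [Set.mem_union, Set.mem_insert_iff, Set.mem_ofPred_eq, List.mem_cons]
      tauto
    · simp only [List.map_cons, hEs, StatelessActor.evalList, hU₂, hU₁]
      rw [hθ₂ (.inl rfl)]

theorem Sim.procCode_map {Y : Set Value} {θ' : Value → Value} (h : Sim prog f θ' Y S S')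
    (hXY : X ⊆ Y) (hθ : Set.EqOn θ' θ X) {P : Proc Value 0} (hP : ∀ u ∈ P.names, u ∈ X) :
    prog.procCode P = prog.procCode (P.map θ) :=
  StatelessActor.procCode_map ((h.iso.mono fun u hu => hXY (hP u hu)).congr
    fun u hu => (hθ (hP u hu)).symm)

end LEVia

/-! ### Running an actor until it is idle -/

section Drain

variable {prog : Program} {A : ActorName} {S T : Config}

/-- The ordering forgets decorations, whereas the rules for a running process require the form `σ ++
[n]`. For the image actor this form is recovered from its ability to move. -/
theorem LStep.exists_deco {α : Label} (h : LStep prog A S α T) {a : ActorState}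
    (hA : S.lookup A = some a) (hne : a.proc ≠ .nil) : ∃ σ n, a.deco = σ ++ [n] := by
  cases h with
  | inst hA' => cases hA.symm.trans hA'; exact (hne rfl).elim
  | letin hA' => cases hA.symm.trans hA'; exact ⟨_, _, rfl⟩
  | invkSelf hA' => cases hA.symm.trans hA'; exact ⟨_, _, rfl⟩
  | invk hA' => cases hA.symm.trans hA'; exact ⟨_, _, rfl⟩
  | condEq hA' => cases hA.symm.trans hA'; exact ⟨_, _, rfl⟩
  | condNe hA' => cases hA.symm.trans hA'; exact ⟨_, _, rfl⟩
  | plusL hA' => cases hA.symm.trans hA'; exact ⟨_, _, rfl⟩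
  | plusR hA' => cases hA.symm.trans hA'; exact ⟨_, _, rfl⟩

/-- From `S` to `T`, the actors other than `A` only receive messages. -/
def Grows (A : ActorName) (S T : Config) : Prop :=
  ∀ B b, B ≠ A → S.lookup B = some b →
    ∃ r, T.lookup B = some ⟨b.deco, b.proc, b.queue ++ r⟩

theorem Grows.refl (A : ActorName) (S : Config) : Grows A S S := fun B b _ hB =>
  ⟨[], by simpa using hB⟩

theorem Grows.trans {T' : Config} (h : Grows A S T) (h' : Grows A T T') : Grows A S T' :=
  fun B b hBA hB => by
    obtain ⟨r, hr⟩ := h B b hBA hB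
    obtain ⟨r', hr'⟩ := h' B _ hBA hr
    exact ⟨r ++ r', by rw [hr', List.append_assoc]⟩

theorem AddsIdle.grows_insert (h : AddsIdle S T) (a : ActorState) : Grows A S (T.insert A a) :=
  fun B b hBA hB => ⟨[], by rw [lookup_insert_eq, if_neg hBA, h.lookup_eq hB, List.append_nil]⟩

theorem addsIdle_of_evalList {Es : List (Expr Value 0)} {U : List Value}
    (h : evalList S Es = (U, T)) : AddsIdle S T := by
  have := evalList_addsIdle Es S
  rwa [h] at this

theorem addsIdle_of_evalOne {E : Expr Value 0} {U : Value}
    (h : evalOne S E = (U, T)) : AddsIdle S T := by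
  have := evalOne_addsIdle S E
  rwa [h] at this

theorem LStep.grows {α : Label} (h : LStep prog A S α T) : Grows A S T := by
  have hS : AddsIdle S S := fun _ => .inl rfl
  cases h with
  | letin hA hE => exact (addsIdle_of_evalOne hE).grows_insert _
  | invkSelf hA hcls hE => exact (addsIdle_of_evalList hE).grows_insert _
  | invk hA hne hA'' hcls hE =>
    intro B b hBA hB
    obtain ⟨r, hr⟩ := (addsIdle_of_evalList hE).grows_insert (A := A) ⟨_, _, _⟩ B b hBA hB
    rw [lookup_insert_eq]
    split_ifs with h
    · subst h
      cases hB.symm.trans hA''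
      exact ⟨_, rfl⟩
    · exact ⟨r, hr⟩
  | inst hA => exact hS.grows_insert _
  | condEq hA hE => exact (addsIdle_of_evalList hE).grows_insert _
  | condNe hA hE => exact (addsIdle_of_evalList hE).grows_insert _
  | plusL hA => exact hS.grows_insert _
  | plusR hA => exact hS.grows_insert _

/-- The termination measure for draining: a running process shrinks, and messages an actor sends to
itself join the end of its queue, behind those still to be reached. -/
theorem LStep.lookup_self {α : Label} (h : LStep prog A S α T) {a : ActorState}
    (hA : S.lookup A = some a) : ∃ a', T.lookup A = some a' ∧
      (a'.proc.size < a.proc.size ∧ (∃ r, a'.queue = a.queue ++ r) ∨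
        a.proc = .nil ∧ ∃ μ, a.queue = μ :: a'.queue) := by
  cases h with
  | letin hA' =>
    cases hA.symm.trans hA'
    exact ⟨_, Finmap.lookup_insert _, .inl ⟨by simp [Proc.size, Proc.size_inst], [], by simp⟩⟩
  | invkSelf hA' =>
    cases hA.symm.trans hA'
    exact ⟨_, Finmap.lookup_insert _, .inl ⟨by simp [Proc.size], _, rfl⟩⟩
  | invk hA' hne =>
    cases hA.symm.trans hA'
    exact ⟨_, (Finmap.lookup_insert_of_ne _ hne.symm).trans (Finmap.lookup_insert _),
      .inl ⟨by simp [Proc.size], [], by simp⟩⟩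
  | inst hA' =>
    cases hA.symm.trans hA'
    exact ⟨_, Finmap.lookup_insert _, .inr ⟨rfl, _, rfl⟩⟩
  | condEq hA' =>
    cases hA.symm.trans hA'
    exact ⟨_, Finmap.lookup_insert _, .inl ⟨by simp only [Proc.size]; omega, [], by simp⟩⟩
  | condNe hA' =>
    cases hA.symm.trans hA'
    exact ⟨_, Finmap.lookup_insert _, .inl ⟨by simp only [Proc.size]; omega, [], by simp⟩⟩
  | plusL hA' =>
    cases hA.symm.trans hA'
    exact ⟨_, Finmap.lookup_insert _, .inl ⟨by simp only [Proc.size]; omega, [], by simp⟩⟩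
  | plusR hA' =>
    cases hA.symm.trans hA'
    exact ⟨_, Finmap.lookup_insert _, .inl ⟨by simp only [Proc.size]; omega, [], by simp⟩⟩

theorem exists_run_to_nil (hprog : prog.NonBlocking) {a : ActorState} {S : Config}
    (hS : prog.Reachable S) (hA : S.lookup A = some a) :
    ∃ T a', Relation.ReflTransGen (AbsStep prog) S T ∧ Grows A S T ∧ T.lookup A = some a' ∧
      a'.proc = .nil ∧ ∃ r, a'.queue = a.queue ++ r := by
  by_cases hn : a.proc = .nil
  · exact ⟨S, a, .refl, .refl A S, hA, hn, [], by simp⟩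
  obtain ⟨α, S₁, hst⟩ := hprog S hS A a hA (.inl hn)
  obtain ⟨a₁, hA₁, ⟨hlt, r₁, hr₁⟩ | ⟨h, -⟩⟩ := hst.lookup_self hA
  · obtain ⟨T, a', hT, hg, hA', hn', r, hr⟩ :=
      exists_run_to_nil hprog (hS.tail ⟨A, α, hst⟩) hA₁
    exact ⟨T, a', hT.head ⟨A, α, hst⟩, hst.grows.trans hg, hA', hn', r₁ ++ r,
      by rw [hr, hr₁, List.append_assoc]⟩
  · exact (hn h).elim
termination_by a.proc.size

/-- Induction on the prefix: take its first message, run the resulting instance to `0`, repeat.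
Everything received on the way lands behind `q`. -/
theorem exists_run_of_queue (hprog : prog.NonBlocking) : (p : List Msg) → {q : List Msg} →
    {a : ActorState} → {S : Config} → prog.Reachable S → S.lookup A = some a → a.proc = .nil →
    a.queue = p ++ q →
    ∃ T a', Relation.ReflTransGen (AbsStep prog) S T ∧ Grows A S T ∧ T.lookup A = some a' ∧
      a'.proc = .nil ∧ ∃ r, a'.queue = q ++ r
  | [], q, a, S, _, hA, hn, hq => ⟨S, a, .refl, .refl A S, hA, hn, [], by simpa using hq⟩
  | μ :: p, q, a, S, hS, hA, hn, hq => by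
    obtain ⟨α, S₁, hst⟩ := hprog S hS A a hA (.inr (by simp [hq]))
    obtain ⟨a₁, hA₁, ⟨hlt, -⟩ | ⟨-, ν, hν⟩⟩ := hst.lookup_self hA
    · rw [hn] at hlt
      simp [Proc.size] at hlt
    obtain ⟨S₂, a₂, hS₂, hg₂, hA₂, hn₂, r, hr⟩ :=
      exists_run_to_nil hprog (hS.tail ⟨A, α, hst⟩) hA₁
    have hq₁ : p ++ q = a₁.queue := (List.cons.inj (hq.symm.trans hν)).2
    rw [← hq₁, List.append_assoc] at hr
    obtain ⟨T, a', hT, hg, hA', hn', r', hr'⟩ := exists_run_of_queue hprog p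
      ((hS.tail ⟨A, α, hst⟩).trans hS₂) hA₂ hn₂ hr
    exact ⟨T, a', (hS₂.trans hT).head ⟨A, α, hst⟩, (hst.grows.trans hg₂).trans hg, hA', hn',
      r ++ r', by rw [hr', List.append_assoc]⟩

end Drain

/-! ### Upward compatibility -/

section Upward

variable {prog : Program} {f : ActorName → ActorName} {S S' T : Config} {A : ActorName}

/-- The state of the image of an actor that is executing a process. -/
theorem Program.LEVia.exists_match (h : prog.LEVia f S S') (hprog : prog.NonBlocking)
    (hS' : prog.Reachable S') {δ : Deco} {Q : Proc Value 0} {q : List Msg}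
    (hA : S.lookup A = some ⟨δ, Q, q⟩) (hQ : Q ≠ .nil) :
    ∃ σ n θ q', S'.lookup (f A) = some ⟨σ ++ [n], Q.map θ, q'⟩ ∧ QueueLE prog q q' ∧
      Sim prog f θ {u | u ∈ Q.names} S S' := by
  obtain ⟨⟨δ', Q', q'⟩, hA', hp, hq⟩ := h.2 A _ hA
  obtain ⟨θ, hθ, rfl⟩ := exists_isoOn_of_procCode (Prod.ext_iff.1 hp).2
  have hQ' : Q.map θ ≠ .nil := fun hn => by
    cases Q <;> simp [Proc.map] at hn hQ
  obtain ⟨α, S₁, hst⟩ := hprog S' hS' _ _ hA' (.inl hQ')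
  obtain ⟨σ, n, rfl : δ' = _⟩ := hst.exists_deco hA' hQ'
  refine ⟨σ, n, θ, q', hA', hq, h, hθ, fun u hu => ⟨A, _, hA, .inr (.inl hu)⟩,
    fun u hu => ⟨f A, _, hA', .inr (.inl ?_)⟩⟩
  rw [Proc.names_map]
  exact List.mem_map_of_mem hu

theorem lookup_zip_map {α β γ : Type*} [BEq α] (g : β → γ) (x : α) : (l : List α) →
    (l' : List β) → (l.zip (l'.map g)).lookup x = ((l.zip l').lookup x).map g
  | [], _ => rfl
  | _ :: _, [] => rfl
  | y :: l, z :: l' => by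
    simp only [List.map_cons, List.zip_cons_cons, List.lookup_cons]
    cases x == y
    · exact lookup_zip_map g x l l'
    · rfl

/-- The renaming between the two messages extends by sending the `i`-th fresh variable of `S` to the
`i`-th of `T`. Both instances number their fresh variables by position in the same list `d.newVars`,
so the extension maps one instance to the other. -/
theorem procCode_instantiate {d : MethodDef} {B B' : ActorName} {U U' : List Value}
    (h : prog.code (.actor B :: U) = prog.code (.actor B' :: U'))
    (hS : ∀ u ∈ Value.actor B :: U, Occurs u S) (hT : ∀ u ∈ Value.actor B' :: U', Occurs u T) :
    prog.procCode (d.instantiate prog S B U) = prog.procCode (d.instantiate prog T B' U') := by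
  obtain ⟨θ, hθ, hL⟩ := exists_isoOn_of_code h
  obtain ⟨θ', hθ', hf, hiso⟩ := hθ.extend (g := fun i => .var (freshVar prog S i))
    (g' := fun i => .var (freshVar prog T i))
    (fun i j hij => freshVar_injective prog S (Value.var.inj hij))
    (fun i j hij => freshVar_injective prog T (Value.var.inj hij))
    (fun i hi => (freshVar_spec prog S i).2 (hS _ hi))
    (by
      rintro i ⟨u, hu, he⟩
      refine (freshVar_spec prog T i).2 (hT _ ?_)
      rw [hL, ← he]
      exact List.mem_map_of_mem hu)
    (fun i => by
      simp only [Program.kind, if_neg (freshVar_spec prog S i).1,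
        if_neg (freshVar_spec prog T i).1])
  rw [List.map_congr_left fun u hu => (hθ' hu).symm, List.map_cons, List.cons.injEq] at hL
  obtain ⟨hB, rfl⟩ := hL
  have hmap : d.instantiate prog T B' (U.map θ') = (d.instantiate prog S B U).map θ' := by
    simp only [MethodDef.instantiate, Proc.map_map]
    congr 1
    funext x
    simp only [Function.comp]
    split_ifs
    · exact hB
    · rw [lookup_zip_map]
      cases (d.params.zip U).lookup x with
      | none => exact (hf _).symm
      | some u => rfl
  rw [hmap]
  refine procCode_map (hiso.mono fun u hu => ?_)
  simp only [MethodDef.instantiate, Proc.names_map, Set.mem_ofPred_eq, List.mem_map] at hu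
  obtain ⟨x, -, rfl⟩ := hu
  split_ifs
  · exact .inl List.mem_cons_self
  · split
    · next u hu =>
      exact .inl (List.mem_cons_of_mem _ (List.of_mem_zip (mem_of_lookup_eq_some hu)).2)
    · exact .inr ⟨_, rfl⟩

/-- Addressee and arguments must be renamed by a single map. The addressee is known through the
original `θ` and the evaluated arguments through its extension `θ'`, which agrees with `θ` on the
addressee. -/
theorem msgCode_eq_of_sim {θ θ' : Value → Value} {X Y : Set Value}
    (h : Sim prog f θ' Y S T) (hθ : Set.EqOn θ' θ X) (hXY : X ⊆ Y) {B B' : ActorName}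
    (hB : .actor B ∈ X) (hB' : θ (.actor B) = .actor B') {U : List Value} (hU : ∀ u ∈ U, u ∈ Y)
    (m : MethName) (σ σ' : Deco) :
    prog.msgCode ⟨m, U, σ, B⟩ = prog.msgCode ⟨m, U.map θ', σ', B'⟩ := by
  simp only [Program.msgCode]
  rw [← hB', ← hθ hB, ← List.map_cons, ← code_map_of_isoOn (h.iso.mono fun u hu => ?_)]
  rcases List.mem_cons.1 hu with rfl | hu
  · exact hXY hB
  · exact hU u hu

theorem mem_of_addsIdle (h : AddsIdle S T) {a : ActorState} (hA : S.lookup A = some a) : A ∈ T :=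
  Finmap.mem_of_lookup_eq_some (h.lookup_eq hA)

/-- Idle actors may be assumed to have the matching message at the head of their queue. -/
theorem Program.LEVia.exists_run_to_message (h : prog.LEVia f S S') (hprog : prog.NonBlocking)
    (hS' : prog.Reachable S') {δ : Deco} {μ : Msg} {q : List Msg}
    (hA : S.lookup A = some ⟨δ, .nil, μ :: q⟩) :
    ∃ T δ' μ' q', Relation.ReflTransGen (AbsStep prog) S' T ∧ prog.LEVia f S T ∧
      T.lookup (f A) = some ⟨δ', .nil, μ' :: q'⟩ ∧ prog.msgCode μ = prog.msgCode μ' ∧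
      QueueLE prog q q' := by
  obtain ⟨⟨δ₀, Q, q₀⟩, hA', hp, hq⟩ := h.2 A _ hA
  obtain ⟨hc, hp⟩ := Prod.ext_iff.1 hp
  obtain ⟨θ, -, rfl : Q = _⟩ := exists_isoOn_of_procCode hp
  obtain ⟨p, μ', r, rfl : q₀ = _, hμ, hr⟩ := exists_of_queueLE_cons hq
  obtain ⟨T, ⟨δ', Q', q'⟩, hT, hg, hAT, rfl : Q' = _, r', rfl : q' = _⟩ :=
    exists_run_of_queue hprog p hS' hA' (by simp [Proc.map]) rfl
  refine ⟨T, δ', μ', r ++ r', hT, ⟨h.1, fun B b hB => ?_⟩, hAT, hμ, queueLE_append_right hr r'⟩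
  by_cases hBA : B = A
  · subst hBA
    cases hA.symm.trans hB
    exact ⟨_, hAT, Prod.ext hc rfl, .cons (msgEquiv_iff.2 hμ) (queueLE_append_right hr r')⟩
  · obtain ⟨b', hb', hp', hq'⟩ := h.2 B b hB
    obtain ⟨s, hs⟩ := hg _ b' (fun he => hBA (h.1 (Finmap.mem_of_lookup_eq_some hB)
      (Finmap.mem_of_lookup_eq_some hA) he)) hb'
    exact ⟨_, hs, hp', queueLE_append_right hq' s⟩

theorem Program.LEVia.exists_step (h : prog.LEVia f S S') (hprog : prog.NonBlocking)
    (hS' : prog.Reachable S') {α : Label} (hst : LStep prog A S α T) :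
    ∃ T', Relation.ReflTransGen (AbsStep prog) S' T' ∧ ConfigLE prog T T' := by
  have hmem : ∀ {a}, S.lookup A = some a → A ∈ S := fun hA => Finmap.mem_of_lookup_eq_some hA
  cases hst with
  | @letin σ n E P q U T hA hE =>
    obtain ⟨σ', n', θ, q', hA', hq, hsim⟩ := h.exists_match hprog hS' hA (by simp)
    obtain ⟨f', θ', hf, hθ, hsim', hU⟩ := hsim.evalOne (E := E) fun u hu => by
      simp [Proc.names, hu]
    simp only [hE] at hsim' hU
    refine ⟨_, .single ⟨f A, _, .letin hA' (Prod.ext hU rfl)⟩, configLE_iff.2 ⟨f', ?_⟩⟩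
    rw [← hf (hmem hA)]
    refine hsim'.le.insert (mem_of_addsIdle (addsIdle_of_evalOne hE) hA) ?_ hq
    rw [Proc.map_congr P fun u hu => (hθ (by simp [Proc.names, hu])).symm, ← Proc.map_inst]
    refine procCode_map (hsim'.iso.mono fun u hu => ?_)
    rcases Proc.mem_names_inst hu with rfl | hu
    · exact .inl rfl
    · exact .inr (by simp [Proc.names, hu])
  | @invkSelf σ n A' m Es P q U T hA hcls hE =>
    obtain ⟨σ', n', θ, q', hA', hq, hsim⟩ := h.exists_match hprog hS' hA (by simp)
    obtain ⟨f', θ', hf, hθ, hsim', hU⟩ := hsim.evalList Es fun E hE u hu =>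
      Proc.mem_names_of_mem_heads hE hu
    simp only [hE] at hsim' hU
    have hn : Value.actor A' ∈ {u | u ∈ (Proc.send (.free (.actor A')) m Es P).names} := by
      simp [Proc.names, Name.names]
    -- Kind preservation makes the renamed addressee an actor of the same class, so delivery to `f
    -- A` is allowed even if `B` is a different actor.
    obtain ⟨B, hB, hBc⟩ := eq_actor_of_kind_eq (hsim.iso.2 _ hn)
    have hcls' : (f A).cls = B.cls := by
      obtain ⟨_, -, hle, -⟩ := h.2 A _ hA
      exact (Prod.ext_iff.1 hle).1.symm.trans (hcls.trans hBc.symm)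
    simp only [Proc.map, Name.map, hB] at hA'
    refine ⟨_, .single ⟨f A, _, .invkSelf hA' hcls' rfl⟩, configLE_iff.2 ⟨f', ?_⟩⟩
    rw [← hf (hmem hA), hU]
    refine hsim'.le.insert (mem_of_addsIdle (addsIdle_of_evalList hE) hA) ?_
      (queueLE_concat hq (msgCode_eq_of_sim hsim' hθ Set.subset_union_left hn hB
        (fun u hu => .inr hu) _ _ _))
    exact hsim'.procCode_map Set.subset_union_left hθ fun u hu => by simp [Proc.names, hu]
  | @invk σ σ'' n A' A'' m Es P P' q q'' U T hA hne hA'' hcls hE =>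
    obtain ⟨σ', n', θ, q', hA', hq, hsim⟩ := h.exists_match hprog hS' hA (by simp)
    obtain ⟨f', θ', hf, hθ, hsim', hU⟩ := hsim.evalList Es fun E hE u hu =>
      Proc.mem_names_of_mem_heads hE hu
    simp only [hE] at hsim' hU
    have hn : Value.actor A' ∈ {u | u ∈ (Proc.send (.free (.actor A')) m Es P).names} := by
      simp [Proc.names, Name.names]
    obtain ⟨B, hB, hBc⟩ := eq_actor_of_kind_eq (hsim.iso.2 _ hn)
    -- Inexact delivery is used here: the message goes to `f A''`, the image of the actual receiver,
    -- whatever its addressee `B` is.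
    obtain ⟨⟨δ, Q, q₁⟩, hfA'', hle, hq₁⟩ := h.2 A'' _ hA''
    have hmem'' := Finmap.mem_of_lookup_eq_some hA''
    have hcls' : (f A'').cls = B.cls :=
      (Prod.ext_iff.1 hle).1.symm.trans (hcls.trans hBc.symm)
    simp only [Proc.map, Name.map, hB] at hA'
    refine ⟨_, .single ⟨f A, _, .invk hA' (fun he => hne (h.1 hmem'' (hmem hA) he)) hfA'' hcls'
      rfl⟩, configLE_iff.2 ⟨f', ?_⟩⟩
    have hT := addsIdle_of_evalList hE
    rw [← hf (hmem hA), ← hf hmem'', hU]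
    refine Program.LEVia.insert (hsim'.le.insert (mem_of_addsIdle hT hA) ?_ hq)
      (Finmap.mem_insert.2 (.inr (mem_of_addsIdle hT hA''))) (Prod.ext_iff.1 hle).2
      (queueLE_concat hq₁ (msgCode_eq_of_sim hsim' hθ Set.subset_union_left hn hB
        (fun u hu => .inr hu) _ _ _))
    exact hsim'.procCode_map Set.subset_union_left hθ fun u hu => by simp [Proc.names, hu]
  | @inst σ σ' C m d U B q hA hcls hd hU =>
    -- The only case that may need more than one step: `f A` first consumes the messages in front of
    -- the matching one.
    obtain ⟨S₁, δ, ⟨m', U', τ, B'⟩, q', hS₁, hle, hA', hμ, hq⟩ :=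
      h.exists_run_to_message hprog hS' hA
    obtain ⟨rfl : m = m', hcode⟩ := Prod.ext_iff.1 hμ
    have hcls' : (f A).cls = some C := by
      obtain ⟨_, -, hle, -⟩ := hle.2 A _ hA
      exact (Prod.ext_iff.1 hle).1.symm.trans hcls
    have hlen : U'.length = d.params.length := by
      have := length_eq_of_code hcode
      simp only [List.length_cons, Nat.add_right_cancel_iff] at this
      rw [← this, hU]
    refine ⟨_, hS₁.tail ⟨f A, _, .inst hA' hcls' hd hlen⟩, configLE_iff.2
      ⟨f, hle.insert (hmem hA) (procCode_instantiate hcode ?_ ?_) hq⟩⟩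
    · intro u hu
      exact ⟨A, _, hA, .inr (.inr ⟨_, List.mem_cons_self, (List.mem_cons.1 hu).symm⟩)⟩
    · intro u hu
      exact ⟨f A, _, hA', .inr (.inr ⟨_, List.mem_cons_self, (List.mem_cons.1 hu).symm⟩)⟩
  | @condEq σ n E E' P Q q U T hA hE =>
    obtain ⟨σ', n', θ, q', hA', hq, hsim⟩ := h.exists_match hprog hS' hA (by simp)
    obtain ⟨f', θ', hf, hθ, hsim', hU⟩ := hsim.evalList [E, E'] fun E hE u hu =>
      Proc.mem_names_of_mem_heads hE hu
    simp only [hE] at hsim' hU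
    refine ⟨_, .single ⟨f A, _, .condEq hA' (Prod.ext hU rfl)⟩, configLE_iff.2 ⟨f', ?_⟩⟩
    rw [← hf (hmem hA)]
    refine hsim'.le.insert (mem_of_addsIdle (addsIdle_of_evalList hE) hA) ?_ hq
    exact hsim'.procCode_map Set.subset_union_left hθ fun u hu => by simp [Proc.names, hu]
  | @condNe σ n E E' P Q q U V T hA hE hne =>
    obtain ⟨σ', n', θ, q', hA', hq, hsim⟩ := h.exists_match hprog hS' hA (by simp)
    obtain ⟨f', θ', hf, hθ, hsim', hU⟩ := hsim.evalList [E, E'] fun E hE u hu =>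
      Proc.mem_names_of_mem_heads hE hu
    simp only [hE] at hsim' hU
    -- Injectivity of the renaming on the evaluated values keeps the test false.
    have hne' : θ' U ≠ θ' V := fun he =>
      hne (hsim'.iso.1 (.inr (by simp)) (.inr (by simp)) he)
    refine ⟨_, .single ⟨f A, _, .condNe hA' (Prod.ext hU rfl) hne'⟩, configLE_iff.2 ⟨f', ?_⟩⟩
    rw [← hf (hmem hA)]
    refine hsim'.le.insert (mem_of_addsIdle (addsIdle_of_evalList hE) hA) ?_ hq
    exact hsim'.procCode_map Set.subset_union_left hθ fun u hu => by simp [Proc.names, hu]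
  | @plusL σ n P Q q hA =>
    obtain ⟨σ', n', θ, q', hA', hq, hsim⟩ := h.exists_match hprog hS' hA (by simp)
    refine ⟨_, .single ⟨f A, _, .plusL hA'⟩, configLE_iff.2 ⟨f, h.insert (hmem hA) ?_ hq⟩⟩
    exact hsim.procCode_map subset_rfl (fun _ _ => rfl) fun u hu => by simp [Proc.names, hu]
  | @plusR σ n P Q q hA =>
    obtain ⟨σ', n', θ, q', hA', hq, hsim⟩ := h.exists_match hprog hS' hA (by simp)
    refine ⟨_, .single ⟨f A, _, .plusR hA'⟩, configLE_iff.2 ⟨f, h.insert (hmem hA) ?_ hq⟩⟩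
    exact hsim.procCode_map subset_rfl (fun _ _ => rfl) fun u hu => by simp [Proc.names, hu]

theorem reflTransGen_reachable {S S' : Config} (hS : prog.Reachable S)
    (h : Relation.ReflTransGen (AbsStep prog) S S') :
    ∃ hS' : prog.Reachable S', Relation.ReflTransGen
      (fun S S' : {S : Config // prog.Reachable S} => AbsStep prog S.1 S'.1) ⟨S, hS⟩ ⟨S', hS'⟩ := by
  induction h with
  | refl => exact ⟨hS, .refl⟩
  | tail _ hst ih =>
    obtain ⟨hS', ih⟩ := ih
    exact ⟨hS'.tail hst, ih.tail hst⟩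

end Upward

end StatelessActor

end

theorem mainTheorem7 (prog : StatelessActor.Program) (hprog : prog.NonBlocking) :
    StatelessActor.IsWSTS (X := {S : StatelessActor.Config // prog.Reachable S})
      (fun S S' => StatelessActor.AbsStep prog S.1 S'.1)
      (fun S S' => StatelessActor.ConfigLE prog S.1 S'.1) where
  finitely_branching S := (StatelessActor.finite_absStep prog S.1).preimage
    (f := Subtype.val) Subtype.val_injective.injOn
  refl S := StatelessActor.configLE_refl S.1
  trans _ _ _ h h' := StatelessActor.configLE_trans h h'
  wqo := StatelessActor.wellQuasiOrdered_configLE prog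
  upward_compatible S₁ S₁' S₂ h hst := by
    obtain ⟨f, hf⟩ := StatelessActor.configLE_iff.1 h
    obtain ⟨A, α, hst⟩ := hst
    obtain ⟨T, hT, hle⟩ := hf.exists_step hprog S₁'.2 hst
    obtain ⟨hTr, hT⟩ := StatelessActor.reflTransGen_reachable S₁'.2 hT
    exact ⟨⟨T, hTr⟩, hT, hle⟩
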